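/- Let $m,n\in\mathbb N=\{0,1,2,\dots\}$ and $M=m-2n$, and assume $M\notin-2\mathbb N=\{0,-2,-4,\dots\}$. Let $\mathcal P=\mathbb R[x_1,\dots,x_m]\otimes\Lambda_{2n}$ be the superalgebra of polynomials in $m$ commuting variables $x_i$ and $2n$ anticommuting variables $\grave x_j$, let $\mathbb E=\sum_i x_i\partial_{x_i}+\sum_j\grave x_j\partial_{\grave x_j}$ and $\nabla^2=\sum_{i=1}^m\partial_{x_i}^2-4\sum_{j=1}^n\partial_{\grave x_{2j-1}}\partial_{\grave x_{2j}}$, and let $\mathcal H_k=\{f\in\mathcal P:\ \mathbb Ef=kf,\ \nabla^2f=0\}$ be the space of spherical harmonics of degree $k\in\mathbb N$. If $m=1$, assume moreover that $k\le 2n+1$ (otherwise $\mathcal H_k=0$). Let $SOSp(m|2n)$ be the Lie supergroup with Harish-Chandra pair $(SO(m)\times Sp(2n),\mathfrak{osp}(m|2n))$. Here $SO(m)\times Sp(2n)$ acts on $\mathcal P$ by $f(\mathbf x)\mapsto f(S^{-1}\mathbf x)$, and $\mathfrak{osp}(m|2n)$ acts by the linear vector fields $X_i\partial_{X^j}-(-1)^{[i][j]}X_j\partial_{X^i}$,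 where $\mathbf x=(X_i)=(x_1,\dots,x_m,\grave x_1,\dots,\grave x_{2n})$, $[i]$ is the parity of $X_i$, and $X^j=\sum_iX_ig^{ij}$ with $\sum_{i,j}X_ig^{ij}X_j=\sum_i x_i^2-\sum_j\grave x_{2j-1}\grave x_{2j}$. Then $\mathcal H_k$ is an irreducible $SOSp(m|2n)$-(co)representation. More precisely: (a) These two actions restrict to $\mathcal H_k$ and make it a representation of the Harish-Chandra pair. It is irreducible: $\mathcal H_k\neq0$, and the only subspaces (graded or not) invariant under $SO(m)\times Sp(2n)$ and $\mathfrak{osp}(m|2n)$ are $0$ and $\mathcal H_k$. (b) There is a unique corepresentation $\chi:\mathcal H_k\to\mathcal O(SOSp(m|2n))\otimes\mathcal H_k$ of the Lie supergroup $SOSp(m|2n)$, that is, an even linear map which satisfies $(\delta_e^\sharp\otimes\mathrm{id})\chi=\mathrm{id}$ and $(\tau\otimes\mathrm{id})(\mathrm{id}\otimes\chi)\chi=(\mu^\sharp\otimes\mathrm{id})\chi$ with $\mu$ the multiplication and $\tau$ the graded flip, that induces the representation in (a), i.e. $(\delta_g^\sharp\otimes\mathrm{id})\chi$ is the action of $g\in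 SO(m)\times Sp(2n)$ and $(\delta_e^\sharp\circ X\otimes\mathrm{id})\chi$ is the action of $X\in\mathfrak{osp}(m|2n)$. It is irreducible: the only subspaces $W\subseteq\mathcal H_k$ (graded or not) with $\chi(W)\subseteq\mathcal O(SOSp(m|2n))\otimes W$ are $0$ and $\mathcal H_k\neq0$. -/

import Mathlib

open Matrix
open scoped TensorProduct ContDiff

noncomputable section

namespace SOSp

/-! ## Superpolynomials and spherical harmonics on `ℝ^{m|2n}` -/

/-- Labels of the coordinates: `inl i` is the even coordinate `x_i`; `inr (inl j)` and
`inr (inr j)` are the odd coordinates `x̀_{2j-1}` and `x̀_{2j}`. -/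
abbrev Idx (m n : ℕ) : Type := Fin m ⊕ (Fin n ⊕ Fin n)

/-- Parity of a coordinate. -/
def par {m n : ℕ} : Idx m n → ZMod 2
  | Sum.inl _ => 0
  | Sum.inr _ => 1

/-- `(-1)^a`. -/
def eps (a : ZMod 2) : ℝ := if a = 0 then 1 else -1

/-- `(-1)^(a b)`. -/
def kos (a b : ZMod 2) : ℝ := if a = 1 ∧ b = 1 then -1 else 1

/-- The superalgebra `ℝ[x_1, …, x_m] ⊗ Λ_{2n}` of superpolynomials. -/
abbrev P (m n : ℕ) : Type :=
  MvPolynomial (Fin m) ℝ ⊗[ℝ] ExteriorAlgebra ℝ (Fin n ⊕ Fin n → ℝ)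

/-- The coordinate `X_i`, as an element of `P`. -/
def coord {m n : ℕ} : Idx m n → P m n
  | Sum.inl i => MvPolynomial.X i ⊗ₜ[ℝ] 1
  | Sum.inr j => 1 ⊗ₜ[ℝ] ExteriorAlgebra.ι ℝ (Pi.single j (1 : ℝ))

/-- The (left) partial derivative with respect to `X_i`; for an odd coordinate this is the
contraction of the exterior algebra, an odd superderivation. -/
def pd {m n : ℕ} : Idx m n → (P m n →ₗ[ℝ] P m n)
  | Sum.inl i => LinearMap.rTensor _
      (MvPolynomial.pderiv (R := ℝ) i).toLinearMap
  | Sum.inr j => LinearMap.lTensor _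
      (CliffordAlgebra.contractLeft (Q := (0 : QuadraticForm ℝ (Fin n ⊕ Fin n → ℝ)))
        (LinearMap.proj j))

/-- The super Euler operator `∑ X_i ∂_{X_i}`. -/
def euler (m n : ℕ) : P m n →ₗ[ℝ] P m n :=
  ∑ i : Idx m n, LinearMap.mulLeft ℝ (coord i) ∘ₗ pd i

/-- The super Laplace operator `∑ ∂_{x_i}² - 4 ∑ ∂_{x̀_{2j-1}} ∂_{x̀_{2j}}`. -/
def laplace (m n : ℕ) : P m n →ₗ[ℝ] P m n :=
  (∑ i : Fin m, pd (Sum.inl i) ∘ₗ pd (Sum.inl i)) -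
    (4 : ℝ) • ∑ j : Fin n, pd (Sum.inr (Sum.inl j)) ∘ₗ pd (Sum.inr (Sum.inr j))

/-- The spherical harmonics of degree `k`: `𝔼 f = k f` and `∇² f = 0`. -/
def H (m n k : ℕ) : Submodule ℝ (P m n) :=
  LinearMap.ker (euler m n - (k : ℝ) • LinearMap.id) ⊓ LinearMap.ker (laplace m n)

/-- The parity automorphism of `P`. -/
def parityP (m n : ℕ) : P m n →ₐ[ℝ] P m n :=
  Algebra.TensorProduct.map (AlgHom.id ℝ _)
    (CliffordAlgebra.involute (Q := (0 : QuadraticForm ℝ (Fin n ⊕ Fin n → ℝ))))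

/-- The even (`a = 0`) and odd (`a = 1`) part of the space of spherical harmonics. -/
def Hgr (m n k : ℕ) (a : ZMod 2) : Submodule ℝ (H m n k) :=
  (LinearMap.ker ((parityP m n).toLinearMap - eps a • LinearMap.id)).comap (H m n k).subtype

/-! ## The Lie group `SO(m) × Sp(2n)` -/

/-- `SO(m) × Sp(2n)`, i.e. pairs `(A, B)` with `Aᵀ A = 1`, `det A = 1`, `Bᵀ J B = J`. -/
abbrev G0 (m n : ℕ) : Type :=
  Matrix.specialOrthogonalGroup (Fin m) ℝ × Matrix.symplecticGroup (Fin n) ℝ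

/-- The vector space of all pairs of matrices (as families of entries), in which `G0` is a closed
submanifold. -/
abbrev Amb (m n : ℕ) : Type :=
  (Fin m → Fin m → ℝ) × (Fin n ⊕ Fin n → Fin n ⊕ Fin n → ℝ)

/-- The pair of matrices `(A, B)` as an element of `Amb`. -/
def mkAmb {m n : ℕ} (A : Matrix (Fin m) (Fin m) ℝ)
    (B : Matrix (Fin n ⊕ Fin n) (Fin n ⊕ Fin n) ℝ) : Amb m n :=
  (fun i j => A i j, fun i j => B i j)

def toAmb {m n : ℕ} (g : G0 m n) : Amb m n := mkAmb g.1.1 g.2.1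

/-- The block diagonal matrix of an element of `G0`. -/
def toMat {m n : ℕ} (g : G0 m n) : Matrix (Idx m n) (Idx m n) ℝ :=
  fromBlocks g.1.1 0 0 g.2.1

/-- `F` is a smooth extension of the function `f` on `G0`. As `G0` is a closed submanifold, the
smooth functions on `G0` are exactly those which have such an extension. -/
def IsExtension {m n : ℕ} (f : G0 m n → ℝ) (F : Amb m n → ℝ) : Prop :=
  ContDiff ℝ ∞ F ∧ ∀ g, F (toAmb g) = f g

/-- `f` is smooth on `G0` and `d/dt f(g exp(tX)) = d` at `t = 0`, for a matrix `X` whose block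
diagonal part is tangent to `G0` at the identity. -/
def HasDerivAlong {m n : ℕ} (f : G0 m n → ℝ) (X : Matrix (Idx m n) (Idx m n) ℝ) (g : G0 m n)
    (d : ℝ) : Prop :=
  ∃ F : Amb m n → ℝ, IsExtension f F ∧
    fderiv ℝ F (toAmb g) (mkAmb (g.1.1 * X.toBlocks₁₁) (g.2.1 * X.toBlocks₂₂)) = d

/-- The action `f(x) ↦ f(g⁻¹ x)` on superpolynomials: the algebra morphism with
`X_i ↦ ∑_j (g⁻¹)_{ij} X_j`. -/
def act {m n : ℕ} (g : G0 m n) : P m n →ₐ[ℝ] P m n :=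
  Algebra.TensorProduct.map
    (MvPolynomial.aeval fun i => ∑ j, MvPolynomial.C ((g⁻¹).1.1 i j) * MvPolynomial.X j)
    (ExteriorAlgebra.map (Matrix.toLin' ((g⁻¹).2.1)ᵀ))

/-! ## The Lie superalgebra `𝔬𝔰𝔭(m|2n)` -/

/-- The supertranspose. -/
def superTranspose {m n : ℕ} (X : Matrix (Idx m n) (Idx m n) ℝ) : Matrix (Idx m n) (Idx m n) ℝ :=
  fromBlocks X.toBlocks₁₁ᵀ X.toBlocks₂₁ᵀ (-X.toBlocks₁₂ᵀ) X.toBlocks₂₂ᵀ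

/-- The matrix `⟨e_i, e_j⟩ = (-1)^([i][j]) g^{ij}` of the supersymmetric bilinear form on the super
vector space `ℝ^{m|2n}` that corresponds to the quadratic superfunction
`R² = ∑ X_i g^{ij} X_j = ∑ x_i² - ∑ x̀_{2j-1} x̀_{2j}`. -/
def form (m n : ℕ) : Matrix (Idx m n) (Idx m n) ℝ :=
  fromBlocks 1 0 0 (-(1 / 2 : ℝ) • Matrix.J (Fin n) ℝ)

/-- `𝔬𝔰𝔭(m|2n)`: the supermatrices `X` with `X^{st} B + B X = 0`, i.e. the homogeneous ones satisfy
`⟨X v, w⟩ + (-1)^(|X||v|) ⟨v, X w⟩ = 0`. -/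
def osp (m n : ℕ) : Submodule ℝ (Matrix (Idx m n) (Idx m n) ℝ) where
  carrier := {X | superTranspose X * form m n + form m n * X = 0}
  zero_mem' := by
    ext i j
    rcases i with i | i <;> rcases j with j | j <;>
      simp [superTranspose, Matrix.mul_apply, toBlocks₁₁, toBlocks₁₂, toBlocks₂₁, toBlocks₂₂]
  add_mem' := by
    intro X Y hX hY
    have h : superTranspose (X + Y) = superTranspose X + superTranspose Y := by
      ext i j
      rcases i with i | i <;> rcases j with j | j <;>
        simp [superTranspose, toBlocks₁₁, toBlocks₁₂, toBlocks₂₁, toBlocks₂₂, add_comm]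
    simp only [Set.mem_ofPred_eq] at hX hY ⊢
    rw [h, add_mul, mul_add, add_add_add_comm, hX, hY, add_zero]
  smul_mem' := by
    intro c X hX
    have h : superTranspose (c • X) = c • superTranspose X := by
      ext i j
      rcases i with i | i <;> rcases j with j | j <;>
        simp [superTranspose, toBlocks₁₁, toBlocks₁₂, toBlocks₂₁, toBlocks₂₂]
    simp only [Set.mem_ofPred_eq] at hX ⊢
    rw [h, smul_mul_assoc, mul_smul_comm, ← smul_add, hX, smul_zero]

/-- The matrix `diag(1, -1)` of the parity of `ℝ^{m|2n}`. -/
def sgnMat (m n : ℕ) : Matrix (Idx m n) (Idx m n) ℝ := fromBlocks 1 0 0 (-1)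

/-- Homogeneous of degree `a`: block diagonal for `a = 0`, block off-diagonal for `a = 1`. -/
def IsHomog {m n : ℕ} (a : ZMod 2) (X : osp m n) : Prop :=
  sgnMat m n * X.1 * sgnMat m n = eps a • X.1

/-- `Z = [X, Y] = X Y - (-1)^(ab) Y X` for `X`, `Y` homogeneous of degrees `a`, `b`. -/
def IsBracket {m n : ℕ} (a b : ZMod 2) (X Y Z : osp m n) : Prop :=
  IsHomog a X ∧ IsHomog b Y ∧ Z.1 = X.1 * Y.1 - kos a b • (Y.1 * X.1)

theorem fromBlocks_toBlocks' {m n : ℕ} (X : Matrix (Idx m n) (Idx m n) ℝ) :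
    ∃ a b c d, X = fromBlocks a b c d :=
  ⟨_, _, _, _, (fromBlocks_toBlocks X).symm⟩

theorem sgnMat_mul_self (m n : ℕ) : sgnMat m n * sgnMat m n = 1 := by
  simp [sgnMat, fromBlocks_multiply]

theorem parity_mem {m n : ℕ} (X : osp m n) : sgnMat m n * X.1 * sgnMat m n ∈ osp m n := by
  have hX : superTranspose X.1 * form m n + form m n * X.1 = 0 := X.2
  have h1 : superTranspose (sgnMat m n * X.1 * sgnMat m n) =
      sgnMat m n * superTranspose X.1 * sgnMat m n := by
    obtain ⟨a, b, c, d, h⟩ := fromBlocks_toBlocks' X.1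
    rw [h]
    simp [sgnMat, superTranspose, fromBlocks_multiply]
  have h2 : sgnMat m n * form m n = form m n * sgnMat m n := by
    simp [sgnMat, form, fromBlocks_multiply]
  change superTranspose _ * form m n + form m n * _ = 0
  calc _ = sgnMat m n * (superTranspose X.1 * form m n + form m n * X.1) * sgnMat m n := by
        rw [h1, mul_add, add_mul]
        congr 1
        · simp only [mul_assoc, h2]
        · simp only [← mul_assoc, h2]
    _ = 0 := by rw [hX, mul_zero, zero_mul]

/-- The parity automorphism of `𝔬𝔰𝔭(m|2n)`: `1` on the even part, `-1` on the odd part. -/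
def ospParity (m n : ℕ) : osp m n →ₗ[ℝ] osp m n where
  toFun X := ⟨sgnMat m n * X.1 * sgnMat m n, parity_mem X⟩
  map_add' X Y := by ext1; simp [mul_add, add_mul]
  map_smul' c X := by ext1; simp

theorem toMat_mul {m n : ℕ} (g h : G0 m n) : toMat (g * h) = toMat g * toMat h := by
  simp [toMat, fromBlocks_multiply]

theorem toMat_inv_mul {m n : ℕ} (g : G0 m n) : toMat g⁻¹ * toMat g = 1 := by
  rw [← toMat_mul, inv_mul_cancel]; simp [toMat]

theorem toMat_mul_inv {m n : ℕ} (g : G0 m n) : toMat g * toMat g⁻¹ = 1 := by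
  rw [← toMat_mul, mul_inv_cancel]; simp [toMat]

theorem toMat_form {m n : ℕ} (g : G0 m n) : (toMat g)ᵀ * form m n * toMat g = form m n := by
  have h1 : g.1.1ᵀ * g.1.1 = 1 := by
    have := (Matrix.mem_specialOrthogonalGroup_iff.1 g.1.2).1
    rw [Matrix.mem_orthogonalGroup_iff'] at this
    simpa [Matrix.star_eq_conjTranspose] using this
  have h2 : g.2.1ᵀ * Matrix.J (Fin n) ℝ * g.2.1 = Matrix.J (Fin n) ℝ :=
    SymplecticGroup.mem_iff'.1 g.2.2
  simp [toMat, form, fromBlocks_transpose, fromBlocks_multiply, h1, h2]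

theorem Ad_mem {m n : ℕ} (g : G0 m n) (X : osp m n) : toMat g * X.1 * toMat g⁻¹ ∈ osp m n := by
  have hX : superTranspose X.1 * form m n + form m n * X.1 = 0 := X.2
  have h1 : superTranspose (toMat g * X.1 * toMat g⁻¹) =
      (toMat g⁻¹)ᵀ * superTranspose X.1 * (toMat g)ᵀ := by
    obtain ⟨a, b, c, d, h⟩ := fromBlocks_toBlocks' X.1
    rw [h]
    simp [toMat, superTranspose, fromBlocks_multiply, fromBlocks_transpose, Matrix.mul_assoc]
  have h2 : (toMat g)ᵀ * form m n = form m n * toMat g⁻¹ := by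
    calc _ = (toMat g)ᵀ * form m n * (toMat g * toMat g⁻¹) := by rw [toMat_mul_inv, mul_one]
      _ = _ := by rw [← mul_assoc, toMat_form]
  have h3 : form m n * toMat g = (toMat g⁻¹)ᵀ * form m n := by
    have := toMat_form g⁻¹
    calc _ = (toMat g⁻¹)ᵀ * form m n * (toMat g⁻¹ * toMat g) := by rw [← mul_assoc, this]
      _ = _ := by rw [toMat_inv_mul, mul_one]
  change superTranspose _ * form m n + form m n * _ = 0
  calc _ = (toMat g⁻¹)ᵀ * (superTranspose X.1 * form m n + form m n * X.1) * toMat g⁻¹ := by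
        rw [h1, mul_add, add_mul]
        congr 1
        · simp only [mul_assoc, h2]
        · simp only [← mul_assoc, h3]
    _ = 0 := by rw [hX, mul_zero, zero_mul]

/-- The adjoint action `Ad(g) X = g X g⁻¹` of `SO(m) × Sp(2n)` on `𝔬𝔰𝔭(m|2n)`. -/
def Ad {m n : ℕ} (g : G0 m n) : osp m n →ₗ[ℝ] osp m n where
  toFun X := ⟨toMat g * X.1 * toMat g⁻¹, Ad_mem g X⟩
  map_add' X Y := by ext1; simp [mul_add, add_mul]
  map_smul' c X := by ext1; simp

/-- The action of `𝔬𝔰𝔭(m|2n)` on superpolynomials by linear vector fields, i.e. by superderivations.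
It extends the contragredient action on the coordinates, `X · φ = -(-1)^(|X||φ|) φ ∘ X`. On the even
part it is the differential of `f(x) ↦ f(g⁻¹ x)`; its image is spanned by the operators
`X_i ∂_{X^j} - (-1)^([i][j]) X_j ∂_{X^i}`. -/
def vf {m n : ℕ} (X : osp m n) : P m n →ₗ[ℝ] P m n :=
  -∑ k : Idx m n, ∑ l : Idx m n, (kos (par k) (par k + par l) * X.1 k l) •
    (LinearMap.mulLeft ℝ (coord l) ∘ₗ pd k)

/-! ## The universal enveloping algebra of `𝔬𝔰𝔭(m|2n)` -/

/-- `X Y - (-1)^(|X||Y|) Y X = [X, Y]`. -/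
inductive URel (m n : ℕ) : TensorAlgebra ℝ (osp m n) → TensorAlgebra ℝ (osp m n) → Prop
  | bracket (a b : ZMod 2) (X Y Z : osp m n) (h : IsBracket a b X Y Z) :
      URel m n (TensorAlgebra.ι ℝ X * TensorAlgebra.ι ℝ Y -
        kos a b • (TensorAlgebra.ι ℝ Y * TensorAlgebra.ι ℝ X)) (TensorAlgebra.ι ℝ Z)

/-- The universal enveloping algebra `U(𝔬𝔰𝔭(m|2n))`. -/
def U (m n : ℕ) : Type := RingQuot (URel m n)

instance (m n : ℕ) : Ring (U m n) := inferInstanceAs (Ring (RingQuot (URel m n)))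

instance (m n : ℕ) : Algebra ℝ (U m n) := inferInstanceAs (Algebra ℝ (RingQuot (URel m n)))

/-- The quotient map from the tensor algebra. -/
def uMk (m n : ℕ) : TensorAlgebra ℝ (osp m n) →ₐ[ℝ] U m n := RingQuot.mkAlgHom ℝ (URel m n)

/-- The canonical map `𝔬𝔰𝔭(m|2n) → U(𝔬𝔰𝔭(m|2n))`. -/
def uι (m n : ℕ) : osp m n →ₗ[ℝ] U m n :=
  (uMk m n).toLinearMap ∘ₗ TensorAlgebra.ι ℝ

theorem uι_bracket {m n : ℕ} {a b : ZMod 2} {X Y Z : osp m n} (h : IsBracket a b X Y Z) :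
    uι m n X * uι m n Y - kos a b • (uι m n Y * uι m n X) = uι m n Z := by
  have h' : uMk m n _ = uMk m n _ := RingQuot.mkAlgHom_rel ℝ (URel.bracket a b X Y Z h)
  simpa [uι] using h'

/-- An algebra endomorphism of `U` from a bracket preserving map of `𝔬𝔰𝔭(m|2n)`. -/
def uMap {m n : ℕ} (f : osp m n →ₗ[ℝ] osp m n)
    (hf : ∀ a b X Y Z, IsBracket a b X Y Z → IsBracket a b (f X) (f Y) (f Z)) :
    U m n →ₐ[ℝ] U m n :=
  RingQuot.liftAlgHom ℝ ⟨TensorAlgebra.lift ℝ (uι m n ∘ₗ f), by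
    rintro _ _ ⟨a, b, X, Y, Z, h⟩
    simpa using uι_bracket (hf a b X Y Z h)⟩

theorem uMap_uι {m n : ℕ} (f : osp m n →ₗ[ℝ] osp m n)
    (hf : ∀ a b X Y Z, IsBracket a b X Y Z → IsBracket a b (f X) (f Y) (f Z)) (X : osp m n) :
    uMap f hf (uι m n X) = uι m n (f X) := by
  have h := RingQuot.liftAlgHom_mkAlgHom_apply ℝ (TensorAlgebra.lift ℝ (uι m n ∘ₗ f)) (s := URel m n)
    (by
      rintro _ _ ⟨a, b, X, Y, Z, h⟩
      simpa using uι_bracket (hf a b X Y Z h)) (TensorAlgebra.ι ℝ X)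
  rw [TensorAlgebra.lift_ι_apply] at h
  exact h

theorem ospParity_bracket {m n : ℕ} (a b : ZMod 2) (X Y Z : osp m n) (h : IsBracket a b X Y Z) :
    IsBracket a b (ospParity m n X) (ospParity m n Y) (ospParity m n Z) := by
  obtain ⟨hX, hY, hZ⟩ := h
  have hs := sgnMat_mul_self m n
  refine ⟨?_, ?_, ?_⟩
  · change sgnMat m n * (sgnMat m n * X.1 * sgnMat m n) * sgnMat m n =
      eps a • (sgnMat m n * X.1 * sgnMat m n)
    rw [show sgnMat m n * X.1 * sgnMat m n = eps a • X.1 from hX, mul_smul_comm, smul_mul_assoc,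
      show sgnMat m n * X.1 * sgnMat m n = eps a • X.1 from hX]
  · change sgnMat m n * (sgnMat m n * Y.1 * sgnMat m n) * sgnMat m n =
      eps b • (sgnMat m n * Y.1 * sgnMat m n)
    rw [show sgnMat m n * Y.1 * sgnMat m n = eps b • Y.1 from hY, mul_smul_comm, smul_mul_assoc,
      show sgnMat m n * Y.1 * sgnMat m n = eps b • Y.1 from hY]
  · change sgnMat m n * Z.1 * sgnMat m n =
      (sgnMat m n * X.1 * sgnMat m n) * (sgnMat m n * Y.1 * sgnMat m n) -
        kos a b • ((sgnMat m n * Y.1 * sgnMat m n) * (sgnMat m n * X.1 * sgnMat m n))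
    have key : ∀ S T : Matrix (Idx m n) (Idx m n) ℝ,
        (sgnMat m n * S * sgnMat m n) * (sgnMat m n * T * sgnMat m n) =
          sgnMat m n * (S * T) * sgnMat m n := by
      intro S T
      calc _ = sgnMat m n * S * (sgnMat m n * sgnMat m n) * T * sgnMat m n := by
            simp only [mul_assoc]
        _ = _ := by rw [hs, mul_one]; simp only [mul_assoc]
    rw [key, key, hZ, mul_sub, sub_mul, mul_smul_comm, smul_mul_assoc]

theorem Ad_bracket {m n : ℕ} (g : G0 m n) (a b : ZMod 2) (X Y Z : osp m n)
    (h : IsBracket a b X Y Z) : IsBracket a b (Ad g X) (Ad g Y) (Ad g Z) := by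
  obtain ⟨hX, hY, hZ⟩ := h
  have hc : ∀ g : G0 m n, sgnMat m n * toMat g = toMat g * sgnMat m n := by
    intro g; simp [sgnMat, toMat, fromBlocks_multiply]
  have hom : ∀ (a : ZMod 2) (X : osp m n), IsHomog a X → IsHomog a (Ad g X) := by
    intro a X hX
    change sgnMat m n * (toMat g * X.1 * toMat g⁻¹) * sgnMat m n =
      eps a • (toMat g * X.1 * toMat g⁻¹)
    calc _ = (sgnMat m n * toMat g) * X.1 * (toMat g⁻¹ * sgnMat m n) := by
          simp only [mul_assoc]
      _ = toMat g * (sgnMat m n * X.1 * sgnMat m n) * toMat g⁻¹ := by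
          rw [hc g, ← hc g⁻¹]; simp only [mul_assoc]
      _ = _ := by
          rw [show sgnMat m n * X.1 * sgnMat m n = eps a • X.1 from hX, mul_smul_comm,
            smul_mul_assoc]
  refine ⟨hom a X hX, hom b Y hY, ?_⟩
  change toMat g * Z.1 * toMat g⁻¹ =
      (toMat g * X.1 * toMat g⁻¹) * (toMat g * Y.1 * toMat g⁻¹) -
        kos a b • ((toMat g * Y.1 * toMat g⁻¹) * (toMat g * X.1 * toMat g⁻¹))
  have key : ∀ S T : Matrix (Idx m n) (Idx m n) ℝ,
      (toMat g * S * toMat g⁻¹) * (toMat g * T * toMat g⁻¹) = toMat g * (S * T) * toMat g⁻¹ := by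
    intro S T
    calc _ = toMat g * S * (toMat g⁻¹ * toMat g) * T * toMat g⁻¹ := by simp only [mul_assoc]
      _ = _ := by rw [toMat_inv_mul, mul_one]; simp only [mul_assoc]
  rw [key, key, hZ, mul_sub, sub_mul, mul_smul_comm, smul_mul_assoc]

/-- The parity automorphism of `U`. -/
def uParity (m n : ℕ) : U m n →ₐ[ℝ] U m n := uMap (ospParity m n) ospParity_bracket

/-- The extension of `Ad(g)` to `U`. -/
def uAd {m n : ℕ} (g : G0 m n) : U m n →ₐ[ℝ] U m n := uMap (Ad g) (Ad_bracket g)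

/-! ## The Lie supergroup `SOSp(m|2n)`

The Lie supergroup of the Harish-Chandra pair `(SO(m) × Sp(2n), 𝔬𝔰𝔭(m|2n))`, in Koszul's model: its
space of superfunctions is `Hom_{U(𝔤₀)}(U(𝔤), C^∞(G₀))`. A superfunction `f` is the family of
smooth functions `f(u) = [D_u f]₀` on `G₀`, where `D_u` is the left invariant differential operator
of `u ∈ U(𝔤)` and `[·]₀` is the restriction to the underlying manifold. So `f(u)(g)` is the value
of `f` at the point distribution `g · u`, and the comultiplication `μ^♯` is dual to the product
`(g · u) (h · w) = g h · (Ad(h⁻¹)u) w` of such distributions. Corepresentations involve only the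
grading, the evaluations and the comultiplication of superfunctions. -/

/-- The space `𝒪(SOSp(m|2n))` of superfunctions, as a subspace of `Hom(U(𝔤), Map(G₀, ℝ))`. -/
def funSub (m n : ℕ) : Submodule ℝ (U m n →ₗ[ℝ] (G0 m n → ℝ)) where
  carrier := {f | (∀ u, ∃ F, IsExtension (f u) F) ∧
    ∀ X : osp m n, IsHomog 0 X → ∀ u g, HasDerivAlong (f u) X.1 g (f (uι m n X * u) g)}
  zero_mem' := by
    have h0 : IsExtension (0 : G0 m n → ℝ) 0 := ⟨contDiff_const, fun _ => rfl⟩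
    exact ⟨fun u => ⟨0, h0⟩, fun X _ u g => ⟨0, h0, by simp⟩⟩
  add_mem' := by
    have hadd : ∀ {f f' : G0 m n → ℝ} {F F' : Amb m n → ℝ}, IsExtension f F →
        IsExtension f' F' → IsExtension (f + f') (F + F') := fun h h' =>
      ⟨h.1.add h'.1, fun g => by simp [h.2 g, h'.2 g]⟩
    intro f f' hf hf'
    refine ⟨fun u => ?_, fun X hX u g => ?_⟩
    · obtain ⟨F, hF⟩ := hf.1 u
      obtain ⟨F', hF'⟩ := hf'.1 u
      exact ⟨F + F', hadd hF hF'⟩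
    · obtain ⟨F, hF, hd⟩ := hf.2 X hX u g
      obtain ⟨F', hF', hd'⟩ := hf'.2 X hX u g
      refine ⟨F + F', hadd hF hF', ?_⟩
      rw [fderiv_add ((hF.1.differentiable (by simp)) _) ((hF'.1.differentiable (by simp)) _)]
      simp [hd, hd']
  smul_mem' := by
    intro c f hf
    have hsm : ∀ {f : G0 m n → ℝ} {F : Amb m n → ℝ}, IsExtension f F →
        IsExtension (c • f) (c • F) := fun h =>
      ⟨contDiff_const.smul h.1, fun g => by simp [h.2 g]⟩
    refine ⟨fun u => ?_, fun X hX u g => ?_⟩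
    · obtain ⟨F, hF⟩ := hf.1 u
      exact ⟨c • F, hsm hF⟩
    · obtain ⟨F, hF, hd⟩ := hf.2 X hX u g
      refine ⟨c • F, hsm hF, ?_⟩
      rw [fderiv_const_smul ((hF.1.differentiable (by simp)) _)]
      simp [hd]

/-- The space `𝒪(SOSp(m|2n))` of superfunctions. -/
def Fun (m n : ℕ) : Type := funSub m n

instance (m n : ℕ) : AddCommGroup (Fun m n) := inferInstanceAs (AddCommGroup (funSub m n))

instance (m n : ℕ) : Module ℝ (Fun m n) := inferInstanceAs (Module ℝ (funSub m n))

theorem funParity_mem {m n : ℕ} (f : Fun m n) : (f.1 ∘ₗ (uParity m n).toLinearMap : U m n →ₗ[ℝ] (G0 m n → ℝ)) ∈ funSub m n := by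
  refine ⟨fun u => f.2.1 _, fun X hX u g => ?_⟩
  have h := f.2.2 X hX (uParity m n u) g
  have hX' : ospParity m n X = X := by
    ext1
    exact (show sgnMat m n * X.1 * sgnMat m n = eps 0 • X.1 from hX).trans (by simp [eps])
  have h2 : uParity m n (uι m n X) = uι m n X := by
    rw [uParity, uMap_uι, hX']
  simpa [h2] using h

/-- The parity operator of `𝒪(SOSp(m|2n))`. -/
def funParity (m n : ℕ) : Fun m n →ₗ[ℝ] Fun m n where
  toFun f := ⟨f.1 ∘ₗ (uParity m n).toLinearMap, funParity_mem f⟩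
  map_add' _ _ := rfl
  map_smul' _ _ := rfl

/-- The even and odd superfunctions. -/
def FunGr (m n : ℕ) (a : ZMod 2) : Submodule ℝ (Fun m n) :=
  LinearMap.ker (funParity m n - eps a • LinearMap.id)

/-- The functional `f ↦ f(u)(g)`. In particular `ev 1 g = δ_g^♯` is the evaluation at the point `g`
and `ev X 1 = δ_e^♯ ∘ X` is the tangent vector `X` at the identity. -/
def ev {m n : ℕ} (u : U m n) (g : G0 m n) : Fun m n →ₗ[ℝ] ℝ where
  toFun f := f.1 u g
  map_add' _ _ := rfl
  map_smul' _ _ := rfl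

/-- Superfunctions on `SOSp(m|2n) × SOSp(m|2n)`, as functions of `(u, w, g, h)`, with
`u ⊗ w ∈ U(𝔤) ⊗ U(𝔤) = U(𝔤 ⊕ 𝔤)`; they are a subspace of the space of all functions, which is used
only to compare them. -/
abbrev Fun2 (m n : ℕ) : Type := U m n → U m n → G0 m n → G0 m n → ℝ

/-- `μ^♯`, with `μ` the multiplication of `SOSp(m|2n)`. -/
def mulSharp (m n : ℕ) : Fun m n →ₗ[ℝ] Fun2 m n where
  toFun f := fun u w g h => ev (uAd h⁻¹ u * w) (g * h) f
  map_add' _ _ := rfl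
  map_smul' _ _ := rfl

/-- The embedding of `𝒪(G) ⊗ 𝒪(G)` in the superfunctions on `G × G`:
`(f ⊗ f')(u ⊗ w)(g, h) = (-1)^(|f'||u|) f(u)(g) f'(w)(h)`, the sign being expressed by parity
operators. -/
def box (m n : ℕ) : Fun m n ⊗[ℝ] Fun m n →ₗ[ℝ] Fun2 m n :=
  TensorProduct.lift <| LinearMap.mk₂ ℝ
    (fun f f' => fun u w g h => (1 / 2 : ℝ) *
      (ev u g f * ev w h f' + ev u g f * ev w h (funParity m n f') +
        ev (uParity m n u) g f * ev w h f' -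
        ev (uParity m n u) g f * ev w h (funParity m n f')))
    (by intros; funext u w g h; simp; ring)
    (by intros; funext u w g h; simp; ring)
    (by intros; funext u w g h; simp; ring)
    (by intros; funext u w g h; simp; ring)

/-- The graded flip `τ(f ⊗ f') = (-1)^(|f||f'|) f' ⊗ f`, the sign being expressed by parity
operators. -/
def flip (m n : ℕ) : Fun m n ⊗[ℝ] Fun m n →ₗ[ℝ] Fun m n ⊗[ℝ] Fun m n :=
  (TensorProduct.comm ℝ (Fun m n) (Fun m n)).toLinearMap ∘ₗ
    ((1 / 2 : ℝ) • (LinearMap.id + TensorProduct.map (funParity m n) LinearMap.id +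
      TensorProduct.map LinearMap.id (funParity m n) -
      TensorProduct.map (funParity m n) (funParity m n)))

/-! ## Representations and corepresentations

`V` is a finite dimensional super vector space, with even part `gr 0` and odd part `gr 1`. -/

/-- A representation of the Harish-Chandra pair `(SO(m) × Sp(2n), 𝔬𝔰𝔭(m|2n))` on `V`. -/
structure HCRep (m n : ℕ) (V : Type) [AddCommGroup V] [Module ℝ V]
    (gr : ZMod 2 → Submodule ℝ V) where
  /-- the action of the group -/
  grp : G0 m n →* (V →ₗ[ℝ] V)
  grp_even : ∀ g a, ∀ v ∈ gr a, grp g v ∈ gr a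
  /-- the action of the Lie superalgebra -/
  alg : osp m n →ₗ[ℝ] (V →ₗ[ℝ] V)
  alg_parity : ∀ a X, IsHomog a X → ∀ b, ∀ v ∈ gr b, alg X v ∈ gr (a + b)
  alg_bracket : ∀ a b X Y Z, IsBracket a b X Y Z →
    alg Z = alg X ∘ₗ alg Y - kos a b • (alg Y ∘ₗ alg X)
  /-- `grp` is smooth, with differential `alg` on the even part -/
  deriv_grp : ∀ X, IsHomog 0 X → ∀ (v : V) (φ : Module.Dual ℝ V),
    HasDerivAlong (fun g => φ (grp g v)) X.1 1 (φ (alg X v))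
  alg_Ad : ∀ g X, alg (Ad g X) = grp g ∘ₗ alg X ∘ₗ grp g⁻¹

/-- The representation is irreducible: `V ≠ 0` and there is no invariant subspace, graded or not,
other than `0` and `V`. -/
def HCRep.IsIrreducible {m n : ℕ} {V : Type} [AddCommGroup V] [Module ℝ V]
    {gr : ZMod 2 → Submodule ℝ V} (R : HCRep m n V gr) : Prop :=
  Nontrivial V ∧ ∀ W : Submodule ℝ V, (∀ g, ∀ w ∈ W, R.grp g w ∈ W) →
    (∀ X, ∀ w ∈ W, R.alg X w ∈ W) → W = ⊥ ∨ W = ⊤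

/-- A corepresentation of the Lie supergroup `SOSp(m|2n)` on `V`. -/
structure Corep (m n : ℕ) (V : Type) [AddCommGroup V] [Module ℝ V]
    (gr : ZMod 2 → Submodule ℝ V) where
  chi : V →ₗ[ℝ] Fun m n ⊗[ℝ] V
  even : ∀ a, ∀ v ∈ gr a, chi v ∈
    ⨆ b : ZMod 2, LinearMap.range (TensorProduct.map (FunGr m n b).subtype (gr (a + b)).subtype)
  /-- `(δ_e^♯ × id) ∘ χ = id` -/
  counit : ∀ v, TensorProduct.lid ℝ V ((ev 1 1).rTensor V (chi v)) = v
  /-- `(τ × id) ∘ (id × χ) ∘ χ = (μ^♯ × id) ∘ χ` -/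
  coassoc : ∀ v,
    (box m n ∘ₗ flip m n).rTensor V
      ((TensorProduct.assoc ℝ (Fun m n) (Fun m n) V).symm (chi.lTensor (Fun m n) (chi v))) =
    (mulSharp m n).rTensor V (chi v)

/-- The corepresentation is irreducible: `V ≠ 0` and there is no subspace `W`, graded or not, with
`χ(W) ⊆ 𝒪(SOSp(m|2n)) ⊗ W`, other than `0` and `V`. -/
def Corep.IsIrreducible {m n : ℕ} {V : Type} [AddCommGroup V] [Module ℝ V]
    {gr : ZMod 2 → Submodule ℝ V} (C : Corep m n V gr) : Prop :=
  Nontrivial V ∧ ∀ W : Submodule ℝ V,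
    (∀ w ∈ W, C.chi w ∈ LinearMap.range (W.subtype.lTensor (Fun m n))) → W = ⊥ ∨ W = ⊤

/-- `R` is the representation of the Harish-Chandra pair induced by `C`:
`π₀(g) = (δ_g^♯ × id) ∘ χ` and `ρ(X) = (δ_e^♯ ∘ X × id) ∘ χ`. -/
def Corep.Induces {m n : ℕ} {V : Type} [AddCommGroup V] [Module ℝ V]
    {gr : ZMod 2 → Submodule ℝ V} (C : Corep m n V gr) (R : HCRep m n V gr) : Prop :=
  (∀ g v, R.grp g v = TensorProduct.lid ℝ V ((ev 1 g).rTensor V (C.chi v))) ∧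
  ∀ X v, R.alg X v = TensorProduct.lid ℝ V ((ev (uι m n X) 1).rTensor V (C.chi v))

end SOSp

end

noncomputable section

namespace SOSp

/-! ## The Weyl–Clifford relations -/

variable {m n : ℕ}

/-! Irreducibility. Write `D j` for `∂_{X^j}`, `Δ` for the Laplacian, and `L i j` for `X_i D_j -
(-1)^([i][j]) X_j D_i`. Every `L i j` is the action of an element of `𝔬𝔰𝔭(m|2n)` (`exists_vf_eq_L`),
so it suffices that an `L`-stable subspace of `H_k` is `0` or `H_k` (`eq_bot_or_eq_H`). This goes by
induction on the degree. Let `W ≠ 0` be `L`-stable in `H_{k+1}`. The span of all `D l w`, `w ∈ W`,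
is `L`-stable because `D l` commutes with `L i j` up to derivatives, and nonzero by Euler's
identity; by induction it is `H_k`. Contracting a product `L i j L j* l` over `j` (`sum_L_L`) shows
that `(M+2k-2) X_i q - R² D_i q` lies in `W` for every `q` in that span, hence for every `q ∈ H_k`.
For arbitrary `h ∈ H_{k+1}` take `q = D_{i*} h` and sum over `i` with the metric: the `R²` term
becomes `R² Δ h = 0`, and Euler's identity leaves `(M+2k-2)(k+1) h ∈ W`. The scalar vanishes only
for `M = 2-2k`. For `k ≥ 1` this is excluded by `M ∉ -2ℕ`; for `k = 0` it means `M = 2`, so `m ≥ 2`,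
and the standard representation is treated by hand (`H_one_le`).

Nonvanishing. The Laplace equation is solved as a Cauchy problem in one even variable, with a
monomial in the other variables as initial derivative (`exists_mem_H_ne_zero`).

Corepresentations. A superfunction is known by its values at the point distributions `g · u`;
contracting `χ(v)` with such a distribution gives its slice. Coassociativity says that slices
compose as distributions multiply, so the slices of any corepresentation inducing `R` must be `v ↦
R.grp g (R.env u v)` (`Corep.Induces.slice_chi`). This gives uniqueness and carries irreducibility
over. Conversely, the matrix coefficients of these operators are superfunctions and define `χ`;
coassociativity then reduces to the compatibility of `R` with `Ad` (`HCRep.toCorep`). -/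

theorem kos_mul_self (a b : ZMod 2) : kos a b * kos a b = 1 := by
  unfold kos; split <;> norm_num

theorem kos_comm (a b : ZMod 2) : kos a b = kos b a := by
  simp only [kos, and_comm]

theorem zmod_two_cases (a : ZMod 2) : a = 0 ∨ a = 1 := by
  revert a; decide

theorem kos_add_left (a b c : ZMod 2) : kos (a + b) c = kos a c * kos b c := by
  have h : (1 : ZMod 2) + 1 = 0 := by decide
  rcases zmod_two_cases a with rfl | rfl <;> rcases zmod_two_cases b with rfl | rfl <;>
    rcases zmod_two_cases c with rfl | rfl <;> simp [kos, h]

theorem kos_add_right (a b c : ZMod 2) : kos a (b + c) = kos a b * kos a c := by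
  rw [kos_comm, kos_add_left, kos_comm b, kos_comm c]

theorem eps_eq_kos (a : ZMod 2) : eps a = kos a 1 := by
  rcases zmod_two_cases a with rfl | rfl <;> simp [kos, eps]

theorem eps_add (a b : ZMod 2) : eps (a + b) = eps a * eps b := by
  simp only [eps_eq_kos, kos_add_left]

theorem eps_mul_self (a : ZMod 2) : eps a * eps a = 1 := by
  unfold eps; split <;> norm_num

/-- The sign `(-1)^([i][j])`. -/
def sg (i j : Idx m n) : ℝ := kos (par i) (par j)

theorem sg_mul_self (i j : Idx m n) : sg i j * sg i j = 1 := kos_mul_self _ _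

theorem sg_comm (i j : Idx m n) : sg i j = sg j i := kos_comm _ _

theorem coord_mul_coord (i j : Idx m n) : coord i * coord j = sg i j • (coord j * coord i) := by
  rcases i with i | i <;> rcases j with j | j
  · simp [coord, sg, kos, par, mul_comm]
  · simp [coord, sg, kos, par]
  · simp [coord, sg, kos, par]
  · have h := ExteriorAlgebra.ι_add_mul_swap (R := ℝ) (Pi.single i (1 : ℝ) : Fin n ⊕ Fin n → ℝ)
      (Pi.single j (1 : ℝ))
    simp only [coord, sg, kos, par, and_self, if_true, Algebra.TensorProduct.tmul_mul_tmul,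
      mul_one]
    rw [eq_neg_of_add_eq_zero_left h, TensorProduct.tmul_neg]
    exact (neg_one_smul ℝ _).symm

theorem coord_mul_coord_mul (i j : Idx m n) (p : P m n) :
    coord i * (coord j * p) = sg i j • (coord j * (coord i * p)) := by
  rw [← mul_assoc, coord_mul_coord, smul_mul_assoc, mul_assoc]

theorem pd_one (i : Idx m n) : pd i (1 : P m n) = 0 := by
  rcases i with i | i <;> simp [pd, Algebra.TensorProduct.one_def]

/-- The canonical super commutation relation. For two odd indices it is the antiderivation rule of
the contraction; in the other cases one factor of the tensor product is untouched. Together with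
`coord_mul_coord` and `pd_one` it drives nearly all operator identities below. -/
theorem pd_coord_mul (i j : Idx m n) (p : P m n) :
    pd i (coord j * p) = (if i = j then (1 : ℝ) else 0) • p + sg i j • (coord j * pd i p) := by
  induction p using TensorProduct.induction_on with
  | zero => simp
  | add p q hp hq => simp only [mul_add, map_add, hp, hq, smul_add]; abel
  | tmul a b =>
    rcases i with i | i <;> rcases j with j | j
    · by_cases h : i = j
      · subst h; simp [pd, coord, sg, kos, par, TensorProduct.add_tmul, add_comm]
      · simp [pd, coord, sg, kos, par, MvPolynomial.pderiv_X, h, Ne.symm h]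
    · simp [pd, coord, sg, kos, par]
    · simp [pd, coord, sg, kos, par]
    · have h := CliffordAlgebra.contractLeft_ι_mul
        (Q := (0 : QuadraticForm ℝ (Fin n ⊕ Fin n → ℝ))) (d := LinearMap.proj i)
        (Pi.single j (1 : ℝ)) b
      simp only [coord, pd, sg, kos, par, and_self, if_true, Algebra.TensorProduct.tmul_mul_tmul,
        one_mul, LinearMap.lTensor_tmul]
      erw [h]
      by_cases hij : i = j
      · subst hij
        simp only [LinearMap.proj_apply, Pi.single_eq_same, one_smul, if_true, sub_eq_add_neg]
        rw [TensorProduct.tmul_add, TensorProduct.tmul_neg]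
        exact congrArg _ (neg_one_smul ℝ _).symm
      · have hij' : (Sum.inr i : Idx m n) ≠ Sum.inr j := fun h => hij (Sum.inr_injective h)
        rw [if_neg hij', LinearMap.proj_apply, Pi.single_eq_of_ne hij, zero_smul, zero_sub,
          TensorProduct.tmul_neg, zero_smul, zero_add]
        exact (neg_one_smul ℝ _).symm

/-- Left multiplications by coordinates generate everything from `1`: first the exterior factor, by
peeling off vectors on the left, then the polynomial factor, whose variables pass freely through the
tensor sign. -/
theorem eq_top_of_coord_mul (N : Submodule ℝ (P m n)) (h1 : (1 : P m n) ∈ N)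
    (hmul : ∀ i, ∀ p ∈ N, coord i * p ∈ N) : N = ⊤ := by
  have hodd : ∀ b : ExteriorAlgebra ℝ (Fin n ⊕ Fin n → ℝ),
      (1 : MvPolynomial (Fin m) ℝ) ⊗ₜ[ℝ] b ∈ N := by
    intro b
    refine CliffordAlgebra.left_induction (Q := (0 : QuadraticForm ℝ (Fin n ⊕ Fin n → ℝ)))
      (P := fun b => (1 : MvPolynomial (Fin m) ℝ) ⊗ₜ[ℝ] b ∈ N) ?_ ?_ ?_ b
    · intro r
      rw [Algebra.algebraMap_eq_smul_one, TensorProduct.tmul_smul]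
      exact N.smul_mem r h1
    · intro x y hx hy
      rw [TensorProduct.tmul_add]; exact N.add_mem hx hy
    · intro x v hx
      have : (1 : MvPolynomial (Fin m) ℝ) ⊗ₜ[ℝ] (ExteriorAlgebra.ι ℝ v * x) =
          ∑ j, v j • (coord (Sum.inr j) * ((1 : MvPolynomial (Fin m) ℝ) ⊗ₜ[ℝ] x)) := by
        conv_lhs => rw [← Finset.univ_sum_single v]
        simp only [coord, Algebra.TensorProduct.tmul_mul_tmul, ← TensorProduct.tmul_smul,
          ← TensorProduct.tmul_sum, ← smul_mul_assoc, ← map_smul, map_sum, Finset.sum_mul,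
          ← Pi.single_smul, smul_eq_mul, mul_one]
      exact this ▸ N.sum_mem fun j _ => N.smul_mem _ (hmul _ _ hx)
  refine eq_top_iff.2 fun p hp => ?_
  clear hp
  induction p using TensorProduct.induction_on with
  | zero => exact N.zero_mem
  | add p q hp hq => exact N.add_mem hp hq
  | tmul a b =>
    induction a using MvPolynomial.induction_on with
    | C r =>
      rw [← MvPolynomial.algebraMap_eq, Algebra.algebraMap_eq_smul_one, ← TensorProduct.smul_tmul']
      exact N.smul_mem r (hodd b)
    | add a a' ha ha' => rw [TensorProduct.add_tmul]; exact N.add_mem ha ha'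
    | mul_X a i ha =>
      have : (a * MvPolynomial.X i) ⊗ₜ[ℝ] b = coord (Sum.inl i) * (a ⊗ₜ[ℝ] b) := by
        simp [coord, mul_comm]
      exact this ▸ hmul _ _ ha

/-- Linear maps on superpolynomials agree when they agree at `1` and their agreement at `p` implies
their agreement at all `X_i p`. -/
theorem eq_of_coord_mul {V : Type*} [AddCommGroup V] [Module ℝ V] {S T : P m n →ₗ[ℝ] V}
    (h1 : S 1 = T 1) (hmul : ∀ i p, S p = T p → S (coord i * p) = T (coord i * p)) : S = T := by
  have := eq_top_of_coord_mul (LinearMap.eqLocus S T) h1 hmul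
  exact LinearMap.ext fun p => (this ▸ Submodule.mem_top : p ∈ LinearMap.eqLocus S T)

theorem pd_pd (i j : Idx m n) (p : P m n) : pd i (pd j p) = sg i j • pd j (pd i p) := by
  have : pd i ∘ₗ pd j = sg i j • (pd j ∘ₗ pd i) := by
    refine eq_of_coord_mul (by simp [pd_one]) fun l p hp => ?_
    simp only [LinearMap.comp_apply, LinearMap.smul_apply] at hp ⊢
    simp only [pd_coord_mul, map_add, map_smul, hp, smul_add, smul_smul, mul_smul_comm]
    have h1 : (if j = l then (1 : ℝ) else 0) = sg i j * (sg i l * if j = l then 1 else 0) := by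
      split_ifs with h
      · subst h; rw [mul_one, sg_mul_self]
      · simp
    have h2 : sg j l * (if i = l then (1 : ℝ) else 0) = sg i j * if i = l then 1 else 0 := by
      split_ifs with h
      · subst h; rw [sg_comm]
      · simp
    match_scalars
    · linear_combination h1
    · linear_combination h2
    · ring
  exact LinearMap.congr_fun this p

theorem parityP_coord (i : Idx m n) : parityP m n (coord i) = eps (par i) • coord i := by
  rcases i with i | i
  · simp [parityP, coord, eps, par]
  · have := CliffordAlgebra.involute_ι (Q := (0 : QuadraticForm ℝ (Fin n ⊕ Fin n → ℝ)))
      (Pi.single i (1 : ℝ))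
    simp only [parityP, coord, Algebra.TensorProduct.map_tmul, map_one]
    erw [this]
    rw [TensorProduct.tmul_neg, eps, if_neg (by simp [par])]
    exact (neg_one_smul ℝ _).symm

theorem parityP_pd (i : Idx m n) (p : P m n) :
    parityP m n (pd i p) = eps (par i) • pd i (parityP m n p) := by
  have : (parityP m n).toLinearMap ∘ₗ pd i = eps (par i) • (pd i ∘ₗ (parityP m n).toLinearMap) := by
    refine eq_of_coord_mul (by simp [pd_one]) fun l p hp => ?_
    simp only [LinearMap.comp_apply, LinearMap.smul_apply, AlgHom.toLinearMap_apply] at hp ⊢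
    simp only [pd_coord_mul, map_add, map_smul, hp, map_mul, parityP_coord, smul_mul_assoc]
    have h1 : (if i = l then (1 : ℝ) else 0) =
        eps (par i) * (eps (par l) * if i = l then 1 else 0) := by
      split_ifs with h
      · subst h; rw [mul_one, eps_mul_self]
      · simp
    rw [mul_smul_comm]
    match_scalars
    · linear_combination h1
    · ring
  exact LinearMap.congr_fun this p

theorem parityP_parityP (p : P m n) : parityP m n (parityP m n p) = p := by
  have : (parityP m n).toLinearMap ∘ₗ (parityP m n).toLinearMap = LinearMap.id := by
    refine eq_of_coord_mul (by simp) fun l p hp => ?_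
    simp only [LinearMap.comp_apply, AlgHom.toLinearMap_apply, LinearMap.id_apply] at hp ⊢
    simp [hp, parityP_coord, smul_smul, eps_mul_self]
  exact LinearMap.congr_fun this p

/-! ## Derivatives with lowered index, the Euler and the Laplace operator -/

/-- The index dual to `i` with respect to the metric. -/
def star : Idx m n → Idx m n
  | Sum.inl i => Sum.inl i
  | Sum.inr (Sum.inl j) => Sum.inr (Sum.inr j)
  | Sum.inr (Sum.inr j) => Sum.inr (Sum.inl j)

/-- The only nonzero entry of row `i` of the metric. -/
def cf : Idx m n → ℝ
  | Sum.inl _ => 1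
  | Sum.inr (Sum.inl _) => 2
  | Sum.inr (Sum.inr _) => -2

/-- The metric `h_{ij} = ∂_{X^i} X_j`. -/
def met (i j : Idx m n) : ℝ := if star i = j then cf i else 0

/-- The derivative `∂_{X^i}`. -/
def D (i : Idx m n) : P m n →ₗ[ℝ] P m n := cf i • pd (star i)

theorem star_star (i : Idx m n) : star (star i) = i := by
  rcases i with i | i | i <;> rfl

theorem star_eq_iff {i j : Idx m n} : star i = j ↔ i = star j :=
  ⟨fun h => by rw [← h, star_star], fun h => by rw [h, star_star]⟩

theorem par_star (i : Idx m n) : par (star i) = par i := by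
  rcases i with i | i | i <;> rfl

theorem sg_star_left (i j : Idx m n) : sg (star i) j = sg i j := by rw [sg, par_star, sg]

theorem sg_star_right (i j : Idx m n) : sg i (star j) = sg i j := by rw [sg, par_star, sg]

theorem cf_ne_zero (i : Idx m n) : cf i ≠ 0 := by
  rcases i with i | i | i <;> simp [cf]

/-- Graded symmetry of the metric: symmetric on even indices, antisymmetric on odd ones. -/
theorem cf_star (i : Idx m n) : cf (star i) = sg i i * cf i := by
  rcases i with i | i | i <;> simp [cf, star, sg, kos, par]

theorem sum_star {V : Type*} [AddCommMonoid V] (f : Idx m n → V) :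
    ∑ i, f (star i) = ∑ i, f i :=
  Fintype.sum_bijective star (Function.Involutive.bijective star_star) _ _ fun _ => rfl

/-- The coefficients `e_i` with `R² = ∑ e_i X_i X_{i*}`. -/
def ec (i : Idx m n) : ℝ := (cf (star i))⁻¹

theorem ec_mul_cf_star (i : Idx m n) : ec i * cf (star i) = 1 :=
  inv_mul_cancel₀ (cf_ne_zero _)

theorem ec_mul_cf (i : Idx m n) : ec i * cf i = sg i i := by
  rcases i with i | i | i <;> simp [ec, cf, star, sg, kos, par]

theorem ec_star (i : Idx m n) : ec (star i) = sg i i * ec i := by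
  rcases i with i | i | i <;> simp [ec, cf, star, sg, kos, par]

theorem D_one (i : Idx m n) : D i (1 : P m n) = 0 := by simp [D, pd_one]

theorem D_coord_mul (i j : Idx m n) (p : P m n) :
    D i (coord j * p) = met i j • p + sg i j • (coord j * D i p) := by
  simp only [D, LinearMap.smul_apply, pd_coord_mul, met, sg_star_left, mul_smul_comm]
  split_ifs <;> module

theorem D_D (i j : Idx m n) (p : P m n) : D i (D j p) = sg i j • D j (D i p) := by
  simp only [D, LinearMap.smul_apply, map_smul, pd_pd (star i) (star j), sg_star_left,
    sg_star_right]
  module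

theorem met_eq_zero_or (i j : Idx m n) : met i j = 0 ∨ star i = j := by
  unfold met; split_ifs with h <;> simp [h]

theorem euler_apply (p : P m n) : euler m n p = ∑ i, coord i * pd i p := by
  simp [euler, LinearMap.sum_apply]

theorem euler_eq_sum_D (p : P m n) : euler m n p = ∑ i, ec i • (coord i * D (star i) p) := by
  rw [euler_apply]
  refine Finset.sum_congr rfl fun i _ => ?_
  rw [D, star_star, LinearMap.smul_apply, mul_smul_comm, smul_smul, ec_mul_cf_star, one_smul]

/-- Each odd pair occurs twice in the sum, with coefficients `2` and `-2`; since odd derivatives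
anticommute the two terms add up to the `-4` of the definition. -/
theorem laplace_eq_sum_D (p : P m n) : laplace m n p = ∑ i, ec i • D i (D (star i) p) := by
  have h : ∀ i : Idx m n, ec i • D i (D (star i) p) = cf i • pd (star i) (pd i p) := by
    intro i
    simp only [D, star_star, LinearMap.smul_apply, map_smul, smul_smul]
    rw [← mul_assoc, ec_mul_cf_star, one_mul]
  rw [Finset.sum_congr rfl fun i _ => h i]
  simp only [Fintype.sum_sum_type, star, cf, one_smul]
  have h2 : ∀ j : Fin n, pd (Sum.inr (Sum.inr j) : Idx m n) (pd (Sum.inr (Sum.inl j)) p) =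
      - pd (Sum.inr (Sum.inl j)) (pd (Sum.inr (Sum.inr j)) p) := by
    intro j; rw [pd_pd, show sg _ _ = (-1 : ℝ) by simp [sg, kos, par]]
    exact neg_one_smul ℝ (M := P m n) _
  simp only [h2, laplace, LinearMap.sub_apply, LinearMap.sum_apply, LinearMap.comp_apply,
    LinearMap.smul_apply, ← Finset.smul_sum, Finset.sum_neg_distrib]
  module

theorem euler_one : euler m n 1 = 0 := by simp [euler_apply, pd_one]

theorem euler_coord_mul (i : Idx m n) (p : P m n) :
    euler m n (coord i * p) = coord i * p + coord i * euler m n p := by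
  simp only [euler_apply, pd_coord_mul, mul_add, mul_smul_comm, Finset.sum_add_distrib,
    Finset.mul_sum, ite_smul, one_smul, zero_smul, mul_ite, mul_zero, Finset.sum_ite_eq',
    Finset.mem_univ, if_true]
  congr 1
  refine Finset.sum_congr rfl fun j _ => ?_
  rw [coord_mul_coord_mul j i, smul_smul, sg_mul_self, one_smul]

theorem euler_pd (i : Idx m n) (p : P m n) :
    euler m n (pd i p) = pd i (euler m n p) - pd i p := by
  have h : ∀ j, pd i (coord j * pd j p) =
      (if i = j then pd j p else 0) + coord j * pd j (pd i p) := by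
    intro j
    rw [pd_coord_mul, pd_pd i j, mul_smul_comm, smul_smul, sg_mul_self, one_smul]
    split_ifs <;> simp
  simp only [euler_apply, map_sum, h, Finset.sum_add_distrib, Finset.sum_ite_eq, Finset.mem_univ,
    if_true, add_sub_cancel_left]

theorem euler_D (i : Idx m n) (p : P m n) : euler m n (D i p) = D i (euler m n p) - D i p := by
  simp only [D, LinearMap.smul_apply, map_smul, euler_pd, smul_sub]

/-- Either of the two derivatives in a summand of the Laplacian can hit `X_i`: the outer one for `j
= i*`, the inner one for `j = i`. Both leave `D i`, whence the factor `2`. -/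
theorem laplace_coord_mul (i : Idx m n) (p : P m n) :
    laplace m n (coord i * p) = (2 : ℝ) • D i p + coord i * laplace m n p := by
  have h : ∀ j, ec j • D j (D (star j) (coord i * p)) =
      (if j = i then D i p else 0) + (if j = star i then D i p else 0) +
        coord i * (ec j • D j (D (star j) p)) := by
    intro j
    simp only [D_coord_mul, map_add, map_smul, smul_add, smul_smul, sg_star_left, mul_smul_comm]
    rw [sg_mul_self, mul_one, add_assoc]
    congr 1
    · by_cases hj : j = i
      · subst hj; simp [met, star_star, ec_mul_cf_star]
      · simp [met, star_star, hj]
    · congr 1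
      by_cases hj : j = star i
      · subst hj
        simp only [met, star_star, if_true, sg_star_left]
        rw [ec_star, mul_mul_mul_comm, ← mul_assoc, sg_mul_self, one_mul]
        rw [ec_mul_cf_star, one_smul]
      · simp [met, star_eq_iff, hj]
  simp only [laplace_eq_sum_D, h, Finset.sum_add_distrib, Finset.sum_ite_eq', Finset.mem_univ,
    if_true, Finset.mul_sum, two_smul]

theorem laplace_D (i : Idx m n) (p : P m n) : laplace m n (D i p) = D i (laplace m n p) := by
  simp only [laplace_eq_sum_D, map_sum, map_smul]
  refine Finset.sum_congr rfl fun j _ => ?_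
  rw [D_D (star j) i, map_smul, D_D j i, sg_star_left, smul_smul, smul_smul,
    mul_assoc, sg_mul_self, mul_one]

theorem laplace_pd (i : Idx m n) (p : P m n) : laplace m n (pd i p) = pd i (laplace m n p) := by
  have h : pd i = (cf (star i))⁻¹ • D (star i) := by
    rw [D, star_star, smul_smul, inv_mul_cancel₀ (cf_ne_zero _), one_smul]
  rw [h, LinearMap.smul_apply, map_smul, laplace_D, LinearMap.smul_apply]

theorem mem_H_iff {k : ℕ} {p : P m n} :
    p ∈ H m n k ↔ euler m n p = (k : ℝ) • p ∧ laplace m n p = 0 := by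
  simp [H, sub_eq_zero]

/-- The operator `X_i ∂_{X^j} - (-1)^([i][j]) X_j ∂_{X^i}`. -/
def L (i j : Idx m n) (p : P m n) : P m n := coord i * D j p - sg i j • (coord j * D i p)

/-- Multiplication by `R²`. -/
def rsq (p : P m n) : P m n := ∑ i, ec i • (coord i * (coord (star i) * p))

/-! ### Contracting a product of two operators `L` over the middle index -/

theorem sum_ec_D_coord_star (q : P m n) :
    ∑ j, ec j • D j (coord (star j) * q) = ((m : ℝ) - 2 * n) • q + euler m n q := by
  have h : ∀ j : Idx m n, ec j • D j (coord (star j) * q) =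
      sg j j • q + ec (star j) • (coord (star j) * D (star (star j)) q) := by
    intro j
    rw [D_coord_mul, sg_star_right, star_star, ec_star, smul_add, smul_smul, smul_smul,
      mul_comm (sg j j)]
    simp [met, ec_mul_cf]
  simp only [h, Finset.sum_add_distrib, sum_star fun j => ec j • (coord j * D (star j) q),
    ← euler_eq_sum_D, ← Finset.sum_smul]
  congr 2
  -- The superdimension `M` enters here, as the supertrace of the identity.
  simp [Fintype.sum_sum_type, sg, kos, par]
  ring

theorem sum_ec_sg_D_coord (l : Idx m n) (p : P m n) :
    ∑ j, (ec j * sg j l) • D j (coord l * D (star j) p) = D l p + coord l * laplace m n p := by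
  have h : ∀ j : Idx m n, (ec j * sg j l) • D j (coord l * D (star j) p) =
      (if j = star l then D l p else 0) + coord l * (ec j • D j (D (star j) p)) := by
    intro j
    rw [D_coord_mul, smul_add, smul_smul, smul_smul, mul_assoc, mul_assoc, sg_mul_self, mul_one,
      mul_smul_comm]
    congr 1
    by_cases hj : j = star l
    · subst hj
      simp only [met, star_star, if_true, sg_star_left]
      rw [ec_star, mul_mul_mul_comm, sg_mul_self, ec_mul_cf_star, one_mul, one_smul]
    · simp [met, star_eq_iff, hj]
  simp only [h, laplace_eq_sum_D, Finset.sum_add_distrib, Finset.sum_ite_eq', Finset.mem_univ,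
    if_true, Finset.mul_sum]

theorem sum_ec_sg_coord_D (i : Idx m n) (q : P m n) :
    ∑ j, (ec j * sg i j) • (coord j * D i (coord (star j) * q)) = coord i * q + rsq (D i q) := by
  have h : ∀ j : Idx m n, (ec j * sg i j) • (coord j * D i (coord (star j) * q)) =
      (if j = i then coord i * q else 0) + ec j • (coord j * (coord (star j) * D i q)) := by
    intro j
    rw [D_coord_mul, sg_star_right, mul_add, mul_smul_comm, mul_smul_comm, smul_add, smul_smul,
      smul_smul, mul_assoc, mul_assoc, sg_mul_self, mul_one]
    congr 1
    by_cases hj : j = i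
    · subst hj
      simp [met, mul_comm (sg j j), ← mul_assoc, ec_mul_cf, sg_mul_self]
    · have : star i ≠ star j := fun h => hj (by rw [← star_star i, h, star_star])
      simp [met, this, hj]
  simp only [h, rsq, Finset.sum_add_distrib, Finset.sum_ite_eq', Finset.mem_univ, if_true]

theorem sum_ec_sg_sg_coord_D (i l : Idx m n) (p : P m n) :
    ∑ j, (ec j * sg i j * sg j l) • (coord j * D i (coord l * D (star j) p)) =
      met i l • euler m n p + sg i l • (coord l * euler m n (D i p)) := by
  have h : ∀ j : Idx m n, (ec j * sg i j * sg j l) • (coord j * D i (coord l * D (star j) p)) =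
      met i l • (ec j • (coord j * D (star j) p)) +
        sg i l • (coord l * (ec j • (coord j * D (star j) (D i p)))) := by
    intro j
    rw [D_coord_mul, D_D i (star j), sg_star_right, mul_smul_comm, mul_add, mul_smul_comm,
      mul_smul_comm, mul_smul_comm, mul_smul_comm, coord_mul_coord_mul j l]
    have h1 : met i l * (sg i j * sg j l) = met i l := by
      rcases met_eq_zero_or i l with h | h
      · simp [h]
      · rw [← h, sg_star_right, sg_comm j i, sg_mul_self, mul_one]
    have h2 := sg_mul_self i j
    have h3 := sg_mul_self j l
    match_scalars
    · linear_combination ec j * h1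
    · linear_combination ec j * sg i l * (sg i j ^ 2 * h3 + h2)
  simp only [h, euler_eq_sum_D, Finset.sum_add_distrib, ← Finset.smul_sum, ← Finset.mul_sum]

/-- Each `L` has two terms, so the product has four; the four preceding contractions evaluate one
each. -/
theorem sum_L_L (i l : Idx m n) (p : P m n) :
    ∑ j, ec j • L i j (L (star j) l p) =
      coord i * (((m : ℝ) - 2 * n) • D l p + euler m n (D l p)) -
        coord i * (D l p + coord l * laplace m n p) - (coord i * D l p + rsq (D i (D l p))) +
        (met i l • euler m n p + sg i l • (coord l * euler m n (D i p))) := by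
  rw [← sum_ec_D_coord_star, ← sum_ec_sg_D_coord, ← sum_ec_sg_coord_D, ← sum_ec_sg_sg_coord_D]
  simp only [Finset.mul_sum, ← Finset.sum_sub_distrib, ← Finset.sum_add_distrib]
  refine Finset.sum_congr rfl fun j _ => ?_
  simp only [L, map_sub, map_smul, mul_sub, sg_star_left, mul_smul_comm]
  module

/-! ## The grading by the Euler operator -/

/-- The space of superpolynomials of degree `d`, as the span of the products of `d` coordinates. -/
def homog (m n : ℕ) : ℕ → Submodule ℝ (P m n)
  | 0 => 1
  | d + 1 => Submodule.span ℝ (Set.range coord) * homog m n d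

theorem homog_le_eigenspace (d : ℕ) :
    homog m n d ≤ Module.End.eigenspace (euler m n) (d : ℝ) := by
  induction d with
  | zero =>
    rw [homog, Submodule.one_le]
    simp [euler_one]
  | succ d ih =>
    rw [homog, Submodule.mul_le]
    intro a ha b hb
    have hb' := Module.End.mem_eigenspace_iff.1 (ih hb)
    induction ha using Submodule.span_induction with
    | mem a ha =>
      obtain ⟨i, rfl⟩ := ha
      rw [Module.End.mem_eigenspace_iff, euler_coord_mul, hb', mul_smul_comm]
      push_cast
      module
    | zero => simp
    | add a a' _ _ h h' => rw [add_mul]; exact Submodule.add_mem _ h h'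
    | smul c a _ h => rw [smul_mul_assoc]; exact Submodule.smul_mem _ c h

theorem iSup_homog : ⨆ d, homog m n d = ⊤ := by
  refine eq_top_of_coord_mul _ ?_ fun i p hp => ?_
  · refine Submodule.mem_iSup_of_mem 0 ?_
    exact Submodule.one_le.1 le_rfl
  · have : ⨆ d, homog m n d ≤ (⨆ d, homog m n d).comap (LinearMap.mulLeft ℝ (coord i)) := by
      refine iSup_le fun d q hq => Submodule.mem_iSup_of_mem (d + 1) ?_
      exact Submodule.mul_mem_mul (Submodule.subset_span ⟨i, rfl⟩) hq
    exact this hp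

theorem iSup_homog_ne_le (c : ℝ) :
    ⨆ (d : ℕ) (_ : (d : ℝ) ≠ c), homog m n d ≤
      ⨆ (x : ℝ) (_ : x ≠ c), Module.End.eigenspace (euler m n) x :=
  iSup₂_le fun d hd => le_iSup₂_of_le (d : ℝ) hd (homog_le_eigenspace d)

theorem disjoint_eigenspace_homog (c : ℝ) :
    Disjoint (Module.End.eigenspace (euler m n) c) (⨆ (d : ℕ) (_ : (d : ℝ) ≠ c), homog m n d) :=
  ((Module.End.eigenspaces_iSupIndep (euler m n)) c).mono_right (iSup_homog_ne_le c)

/-- The spaces `homog m n d` lie in independent eigenspaces and together span everything, so by the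
modular law the eigenspace cannot exceed its homogeneous part. -/
theorem eigenspace_euler (k : ℕ) :
    Module.End.eigenspace (euler m n) (k : ℝ) = homog m n k := by
  refine le_antisymm ?_ (homog_le_eigenspace k)
  have htop : homog m n k ⊔ (⨆ (d : ℕ) (_ : (d : ℝ) ≠ k), homog m n d) = ⊤ := by
    rw [eq_top_iff, ← iSup_homog]
    refine iSup_le fun d => ?_
    by_cases h : (d : ℝ) = k
    · rw [Nat.cast_inj.1 h]; exact le_sup_left
    · exact le_sup_of_le_right (le_iSup₂_of_le d h le_rfl)
  have h := sup_inf_assoc_of_le (⨆ (d : ℕ) (_ : (d : ℝ) ≠ k), homog m n d)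
    (homog_le_eigenspace (m := m) (n := n) k)
  rw [htop, top_inf_eq, inf_comm, (disjoint_eigenspace_homog (k : ℝ)).eq_bot, sup_bot_eq] at h
  exact h.le

/-- Used to kill elements of negative degree, which makes the power series solution below terminate.
-/
theorem eq_zero_of_euler_eq {p : P m n} {c : ℝ} (h : euler m n p = c • p) (hc : ∀ d : ℕ, (d : ℝ) ≠ c) :
    p = 0 := by
  have htop : (⨆ (d : ℕ) (_ : (d : ℝ) ≠ c), homog m n d) = ⊤ := by
    simp only [hc, ne_eq, not_false_eq_true, iSup_pos, iSup_homog]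
  have := disjoint_eigenspace_homog (m := m) (n := n) c
  rw [htop, disjoint_top] at this
  exact (Submodule.mem_bot ℝ).1 (this ▸ Module.End.mem_eigenspace_iff.2 h)

theorem H_le_homog (k : ℕ) : H m n k ≤ homog m n k := fun p hp => by
  rw [← eigenspace_euler]
  exact Module.End.mem_eigenspace_iff.2 (mem_H_iff.1 hp).1

instance finite_H (k : ℕ) : Module.Finite ℝ (H m n k) := by
  have h : (homog m n k).FG := by
    induction k with
    | zero => rw [homog, Submodule.one_eq_span]; exact Submodule.fg_span_singleton _
    | succ k ih => exact Submodule.FG.mul (Submodule.fg_span (Set.finite_range _)) ih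
  have : IsNoetherian ℝ (homog m n k) := isNoetherian_of_fg_of_noetherian _ h
  exact Module.Finite.iff_fg.2 (isNoetherian_submodule.1 this _ (H_le_homog k))

theorem mem_H_zero {p : P m n} (hp : p ∈ H m n 0) : ∃ c : ℝ, p = c • 1 := by
  have := H_le_homog 0 hp
  rw [homog, Submodule.mem_one] at this
  obtain ⟨c, rfl⟩ := this
  exact ⟨c, Algebra.algebraMap_eq_smul_one c⟩

theorem D_mem_H {k : ℕ} {p : P m n} (hp : p ∈ H m n (k + 1)) (i : Idx m n) :
    D i p ∈ H m n k := by
  rw [mem_H_iff] at hp ⊢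
  rw [euler_D, laplace_D, hp.1, hp.2, map_smul, map_zero]
  refine ⟨?_, rfl⟩
  push_cast
  module

/-! ## Irreducibility under the operators `L i j` -/

/-- The derivatives transform among themselves under the `L i j`, like the coordinates do; this
makes `derivSpan W` stable. -/
theorem met_smul_D_L (l i j : Idx m n) (p : P m n) :
    L i j (D l p) = (sg l i * sg l j) •
      (D l (L i j p) - met l i • D j p + (sg i j * met l j) • D i p) := by
  simp only [L, map_sub, map_smul, D_coord_mul, D_D l, mul_smul_comm]
  have h1 := sg_mul_self l i
  have h2 := sg_mul_self l j
  match_scalars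
  · linear_combination -h1 * sg l j ^ 2 - h2
  · linear_combination (h1 * sg l j ^ 2 + h2) * sg i j
  · ring
  · ring

/-- The span of the derivatives of the elements of `W`. -/
def derivSpan (W : Submodule ℝ (P m n)) : Submodule ℝ (P m n) := ⨆ l, W.map (D l)

theorem D_mem_derivSpan {W : Submodule ℝ (P m n)} {w : P m n} (hw : w ∈ W) (l : Idx m n) :
    D l w ∈ derivSpan W :=
  Submodule.mem_iSup_of_mem l ⟨w, hw, rfl⟩

theorem L_mem_derivSpan {W : Submodule ℝ (P m n)} (hW : ∀ i j, ∀ w ∈ W, L i j w ∈ W) (i j : Idx m n)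
    {w : P m n} (hw : w ∈ derivSpan W) : L i j w ∈ derivSpan W := by
  let T : P m n →ₗ[ℝ] P m n :=
    LinearMap.mulLeft ℝ (coord i) ∘ₗ D j - sg i j • (LinearMap.mulLeft ℝ (coord j) ∘ₗ D i)
  have : derivSpan W ≤ (derivSpan W).comap T := by
    refine iSup_le fun l => ?_
    rintro _ ⟨w, hw, rfl⟩
    change L i j (D l w) ∈ derivSpan W
    rw [met_smul_D_L]
    refine Submodule.smul_mem _ _ (Submodule.add_mem _ (Submodule.sub_mem _ ?_ ?_) ?_)
    · exact D_mem_derivSpan (hW i j w hw) l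
    · exact Submodule.smul_mem _ _ (D_mem_derivSpan hw j)
    · exact Submodule.smul_mem _ _ (D_mem_derivSpan hw i)
  exact this hw

/-- Euler's identity recovers `(k+1) w` from the derivatives of `w`. -/
theorem eq_zero_of_D_eq_zero {k : ℕ} {w : P m n} (hw : w ∈ H m n (k + 1)) (h : ∀ l, D l w = 0) :
    w = 0 := by
  have h1 := (mem_H_iff.1 hw).1
  rw [euler_eq_sum_D] at h1
  simp only [h, mul_zero, smul_zero, Finset.sum_const_zero] at h1
  have h2 : ((k + 1 : ℕ) : ℝ) ≠ 0 := by positivity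
  exact (smul_eq_zero.1 h1.symm).resolve_left h2

/-- The right side visibly lies in every `L`-stable subspace containing `w`. Adding `k • L i l w`
cancels the term `X_l D_i w` of `sum_L_L` and raises the coefficient of `X_i D_l w` from `M+k-2` to
`M+2k-2`. -/
theorem sum_L_L_of_mem_H {k : ℕ} {w : P m n} (hw : w ∈ H m n (k + 1)) (i l : Idx m n) :
    ((m : ℝ) - 2 * n + 2 * k - 2) • (coord i * D l w) - rsq (D i (D l w)) =
      ∑ j, ec j • L i j (L (star j) l w) + (k : ℝ) • L i l w - ((k + 1) * met i l : ℝ) • w := by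
  have h1 := mem_H_iff.1 hw
  rw [sum_L_L, (mem_H_iff.1 (D_mem_H hw l)).1, (mem_H_iff.1 (D_mem_H hw i)).1, h1.1, h1.2, L]
  simp only [mul_zero, add_zero, mul_add, mul_smul_comm]
  push_cast
  module

/-- The left side of `sum_L_L_of_mem_H` depends on `w` only through `D l w`, and linearly, so
membership extends to the whole span. -/
theorem rsq_D_mem {k : ℕ} {W : Submodule ℝ (P m n)} (hWH : W ≤ H m n (k + 1))
    (hW : ∀ i j, ∀ w ∈ W, L i j w ∈ W) (i : Idx m n) {q : P m n} (hq : q ∈ derivSpan W) :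
    ((m : ℝ) - 2 * n + 2 * k - 2) • (coord i * q) - rsq (D i q) ∈ W := by
  let T : P m n →ₗ[ℝ] P m n := ((m : ℝ) - 2 * n + 2 * k - 2) • LinearMap.mulLeft ℝ (coord i) -
    (∑ j, ec j • (LinearMap.mulLeft ℝ (coord j) ∘ₗ LinearMap.mulLeft ℝ (coord (star j)))) ∘ₗ D i
  have hT : ∀ q, T q = ((m : ℝ) - 2 * n + 2 * k - 2) • (coord i * q) - rsq (D i q) := by
    intro q; simp [T, rsq, LinearMap.sum_apply]
  have : derivSpan W ≤ W.comap T := by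
    refine iSup_le fun l => ?_
    rintro _ ⟨w, hw, rfl⟩
    rw [Submodule.mem_comap, hT, sum_L_L_of_mem_H (hWH hw)]
    exact W.sub_mem (W.add_mem (W.sum_mem fun j _ => W.smul_mem _ (hW _ _ _ (hW _ _ _ hw)))
      (W.smul_mem _ (hW _ _ _ hw))) (W.smul_mem _ hw)
  rw [← hT]
  exact this hq

theorem le_of_derivSpan_eq {k : ℕ} {W : Submodule ℝ (P m n)} (hWH : W ≤ H m n (k + 1))
    (hW : ∀ i j, ∀ w ∈ W, L i j w ∈ W) (hc : (m : ℝ) - 2 * n + 2 * k - 2 ≠ 0)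
    (hd : derivSpan W = H m n k) : H m n (k + 1) ≤ W := by
  intro h hh
  have h1 := mem_H_iff.1 hh
  -- The `R²` terms assemble to `R²` times the Laplacian of `h`, which is zero; the rest is Euler's
  -- identity in degree `k+1`.
  have key : (((m : ℝ) - 2 * n + 2 * k - 2) * (k + 1)) • h = ∑ i, ec i •
      (((m : ℝ) - 2 * n + 2 * k - 2) • (coord i * D (star i) h) - rsq (D i (D (star i) h))) := by
    have h2 : ∑ i, ec i • rsq (D i (D (star i) h)) = rsq (laplace m n h) := by
      simp only [laplace_eq_sum_D, rsq, Finset.smul_sum, Finset.mul_sum,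
        mul_smul_comm]
      rw [Finset.sum_comm]
      exact Finset.sum_congr rfl fun i _ => Finset.sum_congr rfl fun j _ => smul_comm _ _ _
    have h3 : rsq (0 : P m n) = 0 := by simp [rsq]
    simp only [smul_sub, Finset.sum_sub_distrib]
    rw [h2, h1.2, h3, sub_zero]
    simp only [smul_comm _ ((m : ℝ) - 2 * n + 2 * k - 2), ← Finset.smul_sum, ← euler_eq_sum_D]
    rw [h1.1, smul_smul]
    push_cast
    rfl
  have hk : ((k : ℝ) + 1) ≠ 0 := by positivity
  refine (W.smul_mem_iff (mul_ne_zero hc hk)).1 (key ▸ W.sum_mem fun i _ => W.smul_mem _ ?_)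
  -- Although `h` is not yet known to lie in `W`, its derivatives lie in `H m n k`, which is the
  -- span of the derivatives of `W`.
  exact rsq_D_mem hWH hW i (hd ▸ D_mem_H hh _)

theorem L_coord (i j l : Idx m n) :
    L i j (coord l : P m n) = met j l • coord i - (sg i j * met i l) • coord j := by
  have h : ∀ a b : Idx m n, D a (coord b : P m n) = met a b • 1 := by
    intro a b
    have := D_coord_mul a b (1 : P m n)
    simpa [D_one] using this
  simp only [L, h, mul_smul_comm, mul_one, smul_smul]

theorem H_one_le_of_coord_mem {W : Submodule ℝ (P m n)} (h : ∀ i, coord i ∈ W) : H m n 1 ≤ W := by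
  refine (H_le_homog 1).trans ?_
  rw [homog, Submodule.mul_le]
  intro a ha b hb
  obtain ⟨c, rfl⟩ := Submodule.mem_one.1 hb
  rw [← Algebra.commutes, ← Algebra.smul_def]
  refine W.smul_mem c ((Submodule.span_le.2 ?_ : _ ≤ W) ha)
  rintro _ ⟨i, rfl⟩
  exact h i

/-- The case of `H 1`, which is the standard representation. -/
theorem H_one_le {W : Submodule ℝ (P m n)} (hWH : W ≤ H m n 1)
    (hW : ∀ i j, ∀ w ∈ W, L i j w ∈ W) (hm : 2 ≤ m) (h0 : W ≠ ⊥) : H m n 1 ≤ W := by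
  obtain ⟨w, hw, hw0⟩ := W.ne_bot_iff.1 h0
  -- `w` is a linear form, and `c` is its constant gradient.
  obtain ⟨c, hc⟩ : ∃ c : Idx m n → ℝ, ∀ l, D l w = c l • 1 :=
    Classical.axiom_of_choice fun l => mem_H_zero (D_mem_H (hWH hw) l)
  have hL : ∀ i j, c j • coord i - (sg i j * c i) • coord j ∈ W := by
    intro i j
    have := hW i j w hw
    simpa only [L, hc, mul_smul_comm, mul_one, smul_smul] using this
  obtain ⟨l, hl⟩ : ∃ l, c l ≠ 0 := by
    by_contra! h
    exact hw0 (eq_zero_of_D_eq_zero (hWH hw) fun l => by rw [hc, h, zero_smul])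
  -- it is enough to find an even coordinate in `W`
  have of_even : ∀ i : Fin m, coord (Sum.inl i) ∈ W → H m n 1 ≤ W := by
    refine fun i hi => H_one_le_of_coord_mem fun j => ?_
    by_cases hj : j = Sum.inl i
    · rwa [hj]
    · have h1 : met j (Sum.inl i : Idx m n) = 0 := if_neg fun h => hj (by rw [star_eq_iff.1 h]; rfl)
      have h2 : met (Sum.inl i : Idx m n) (Sum.inl i) = 1 := by simp [met, star, cf]
      simpa [L_coord, h1, h2] using hW j (Sum.inl i) _ hi
  rcases l with l | l
  -- Two even directions: `L i l w` is a vector in the plane of `x_i, x_l`, and a second application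
  -- of `L i l` rotates it by a right angle. Combining the two isolates `x_i` with coefficient `c_l²
  -- + c_i²`, positive over the reals.
  · obtain ⟨i, hi⟩ : ∃ i : Fin m, i ≠ l :=
      haveI := Fin.nontrivial_iff_two_le.2 hm
      exists_ne l
    have hne : (Sum.inl i : Idx m n) ≠ Sum.inl l := fun h => hi (Sum.inl_injective h)
    have h1 := hL (Sum.inl i) (Sum.inl l)
    have h2 := hW (Sum.inl i) (Sum.inl l) _ h1
    have h3 : L (Sum.inl i : Idx m n) (Sum.inl l) (c (Sum.inl l) • coord (Sum.inl i) -
        (sg (Sum.inl i : Idx m n) (Sum.inl l) * c (Sum.inl i)) • coord (Sum.inl l)) =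
        -c (Sum.inl i) • coord (Sum.inl i) - c (Sum.inl l) • coord (Sum.inl l) := by
      have hlin : ∀ (a b : ℝ) (p q : P m n), L (Sum.inl i : Idx m n) (Sum.inl l) (a • p - b • q) =
          a • L (Sum.inl i) (Sum.inl l) p - b • L (Sum.inl i) (Sum.inl l) q := by
        intro a b p q
        simp only [L, map_sub, map_smul, mul_sub, mul_smul_comm]
        module
      rw [hlin, L_coord, L_coord]
      simp only [met, star, hne, hne.symm, cf, sg, kos, par, if_true, if_false]
      norm_num
      module
    rw [h3] at h2
    refine of_even i ((W.smul_mem_iff (x := coord (Sum.inl i))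
      (s := c (Sum.inl l) ^ 2 + c (Sum.inl i) ^ 2) (by positivity)).1 ?_)
    have h4 := W.sub_mem (W.smul_mem (c (Sum.inl l)) h1) (W.smul_mem (c (Sum.inl i)) h2)
    convert h4 using 1
    simp only [sg, kos, par]
    norm_num
    module
  -- For an odd index `L l l` is not zero: its two terms add up, giving `2 c_l X_l`. An operator
  -- mixing parities then carries `X_l` to an even coordinate.
  · have h1 := hL (Sum.inr l) (Sum.inr l)
    have h2 : coord (Sum.inr l) ∈ W := by
      refine (W.smul_mem_iff (s := 2 * c (Sum.inr l)) (by positivity)).1 ?_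
      convert h1 using 1
      simp only [sg, kos, par]
      norm_num
      module
    have i : Fin m := ⟨0, by omega⟩
    have h3 := hW (Sum.inl i) (star (Sum.inr l)) _ h2
    have h4 : met (Sum.inl i : Idx m n) (Sum.inr l) = 0 := by simp [met, star]
    have h5 : met (star (Sum.inr l) : Idx m n) (Sum.inr l) =
        cf (star (Sum.inr l) : Idx m n) := by
      simp [met, star_star]
    rw [L_coord, h4, h5, mul_zero, zero_smul, sub_zero] at h3
    exact of_even i ((W.smul_mem_iff (cf_ne_zero _)).1 h3)

/-- A subspace of `H k` that is stable under all `L i j` is trivial. -/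
theorem eq_bot_or_eq_H (hM : ∀ j : ℕ, (m : ℤ) - 2 * (n : ℤ) ≠ -2 * (j : ℤ)) (k : ℕ)
    (W : Submodule ℝ (P m n)) (hWH : W ≤ H m n k) (hW : ∀ i j, ∀ w ∈ W, L i j w ∈ W) :
    W = ⊥ ∨ W = H m n k := by
  induction k generalizing W with
  | zero =>
    refine or_iff_not_imp_left.2 fun h0 => le_antisymm hWH fun h hh => ?_
    obtain ⟨w, hw, hw0⟩ := W.ne_bot_iff.1 h0
    obtain ⟨c, rfl⟩ := mem_H_zero (hWH hw)
    obtain ⟨d, rfl⟩ := mem_H_zero hh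
    have hc : c ≠ 0 := fun hc => hw0 (by rw [hc, zero_smul])
    exact W.smul_mem d ((W.smul_mem_iff hc).1 hw)
  | succ k ih =>
    refine or_iff_not_imp_left.2 fun h0 => le_antisymm hWH ?_
    obtain ⟨w, hw, hw0⟩ := W.ne_bot_iff.1 h0
    have hd : derivSpan W = H m n k := by
      refine (ih (derivSpan W) (iSup_le fun l => ?_) fun i j w hw =>
        L_mem_derivSpan hW i j hw).resolve_left fun hbot => ?_
      · rintro _ ⟨w, hw, rfl⟩
        exact D_mem_H (hWH hw) l
      · refine hw0 (eq_zero_of_D_eq_zero (hWH hw) fun l => ?_)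
        have := D_mem_derivSpan hw l
        rwa [hbot, Submodule.mem_bot] at this
    -- The degenerate scalar: in degree one it forces `M = 2`, hence `m ≥ 2`; in higher degree it
    -- makes `M` a nonpositive even integer.
    by_cases hc : (m : ℝ) - 2 * n + 2 * k - 2 = 0
    · have hc' : (m : ℤ) - 2 * n + 2 * k - 2 = 0 := by exact_mod_cast hc
      rcases k with _ | k
      · exact H_one_le hWH hW (by omega) h0
      · exact absurd (by push_cast at hc'; linarith) (hM k)
    · exact le_of_derivSpan_eq hWH hW hc hd

/-! ## Existence of nonzero spherical harmonics -/

theorem euler_laplace (p : P m n) :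
    euler m n (laplace m n p) = laplace m n (euler m n p) - (2 : ℝ) • laplace m n p := by
  simp only [laplace_eq_sum_D, map_sum, map_smul, euler_D, map_sub, Finset.smul_sum,
    ← Finset.sum_sub_distrib]
  exact Finset.sum_congr rfl fun i _ => by module

theorem euler_coord_pow_mul (i : Idx m n) (r : ℕ) (q : P m n) :
    euler m n (coord i ^ r * q) = (r : ℝ) • (coord i ^ r * q) + coord i ^ r * euler m n q := by
  induction r with
  | zero => simp
  | succ r ih =>
    rw [pow_succ', mul_assoc, euler_coord_mul, ih, mul_add, mul_smul_comm, mul_assoc]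
    push_cast
    module

theorem pd_coord_pow_mul (i : Fin m) (r : ℕ) {q : P m n} (hq : pd (Sum.inl i) q = 0) :
    pd (Sum.inl i) (coord (Sum.inl i) ^ (r + 1) * q) =
      ((r : ℝ) + 1) • (coord (Sum.inl i) ^ r * q) := by
  have h1 : sg (Sum.inl i : Idx m n) (Sum.inl i) = 1 := by simp [sg, kos, par]
  induction r with
  | zero => simp [pd_coord_mul, hq]
  | succ r ih =>
    rw [pow_succ', mul_assoc, pd_coord_mul, ih, mul_smul_comm, ← mul_assoc, ← pow_succ', h1,
      if_pos rfl]
    push_cast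
    module

/-- The part of the Laplace operator without the variable `x_i`. -/
def laplaceOff (i : Fin m) : P m n →ₗ[ℝ] P m n :=
  laplace m n - pd (Sum.inl i) ∘ₗ pd (Sum.inl i)

theorem laplaceOff_coord_mul (i : Fin m) (p : P m n) :
    laplaceOff i (coord (Sum.inl i) * p) = coord (Sum.inl i) * laplaceOff i p := by
  have h1 : sg (Sum.inl i : Idx m n) (Sum.inl i) = 1 := by simp [sg, kos, par]
  have h2 : (D (Sum.inl i) : P m n →ₗ[ℝ] P m n) = pd (Sum.inl i) := by simp [D, cf, star]
  simp only [laplaceOff, LinearMap.sub_apply, LinearMap.comp_apply, laplace_coord_mul,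
    pd_coord_mul, if_true, h1, h2, map_add, map_smul, mul_sub]
  module

theorem laplaceOff_coord_pow_mul (i : Fin m) (r : ℕ) (p : P m n) :
    laplaceOff i (coord (Sum.inl i) ^ r * p) = coord (Sum.inl i) ^ r * laplaceOff i p := by
  induction r with
  | zero => simp
  | succ r ih => rw [pow_succ', mul_assoc, laplaceOff_coord_mul, ih, mul_assoc]

theorem pd_laplaceOff (i : Fin m) (p : P m n) :
    pd (Sum.inl i) (laplaceOff i p) = laplaceOff i (pd (Sum.inl i) p) := by
  simp only [laplaceOff, LinearMap.sub_apply, LinearMap.comp_apply, map_sub, laplace_pd]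

theorem euler_laplaceOff (i : Fin m) (p : P m n) :
    euler m n (laplaceOff i p) = laplaceOff i (euler m n p) - (2 : ℝ) • laplaceOff i p := by
  simp only [laplaceOff, LinearMap.sub_apply, LinearMap.comp_apply, map_sub, euler_laplace,
    euler_pd]
  module

theorem pd_laplaceOff_pow (i : Fin m) (j : ℕ) {g : P m n} (hg : pd (Sum.inl i) g = 0) :
    pd (Sum.inl i) ((laplaceOff i ^ j) g) = 0 := by
  induction j with
  | zero => simpa
  | succ j ih => rw [pow_succ', Module.End.mul_apply, pd_laplaceOff, ih, map_zero]

theorem euler_laplaceOff_pow (i : Fin m) (j : ℕ) {g : P m n} {d : ℝ}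
    (hg : euler m n g = d • g) :
    euler m n ((laplaceOff i ^ j) g) = (d - 2 * j) • (laplaceOff i ^ j) g := by
  induction j with
  | zero => simpa
  | succ j ih =>
    rw [pow_succ', Module.End.mul_apply, euler_laplaceOff, ih, map_smul]
    push_cast
    module

/-- The degree would be `d - 2(d+1) < 0`. This bound is crude but is all that the truncation needs.
-/
theorem laplaceOff_pow_eq_zero (i : Fin m) {g : P m n} {d : ℕ}
    (hg : euler m n g = (d : ℝ) • g) : (laplaceOff i ^ (d + 1)) g = 0 := by
  refine eq_zero_of_euler_eq (euler_laplaceOff_pow i (d + 1) hg) fun e he => ?_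
  have : (e : ℤ) = d - 2 * ((d + 1 : ℕ) : ℤ) := by exact_mod_cast he
  omega

/-- The solution `∑ (-1)^j x_i^(2j+1)/(2j+1)! Δ'^j g` of the Laplace equation. -/
def oddSolution (i : Fin m) (d : ℕ) (g : P m n) : P m n :=
  ∑ j ∈ Finset.range (d + 1), ((-1 : ℝ) ^ j / ((2 * j + 1).factorial : ℝ)) •
    (coord (Sum.inl i) ^ (2 * j + 1) * (laplaceOff i ^ j) g)

/-- The sine-type series differentiates to the cosine-type one, whose value at `x_i = 0` is the
datum `g`. -/
theorem pd_oddSolution (i : Fin m) (d : ℕ) {g : P m n} (hg : pd (Sum.inl i) g = 0) :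
    pd (Sum.inl i) (oddSolution i d g) =
      ∑ j ∈ Finset.range (d + 1), ((-1 : ℝ) ^ j / ((2 * j).factorial : ℝ)) •
        (coord (Sum.inl i) ^ (2 * j) * (laplaceOff i ^ j) g) := by
  simp only [oddSolution, map_sum, map_smul]
  refine Finset.sum_congr rfl fun j _ => ?_
  rw [pd_coord_pow_mul i (2 * j) (pd_laplaceOff_pow i j hg), smul_smul, Nat.factorial_succ]
  congr 1
  have : ((2 * j).factorial : ℝ) ≠ 0 := by positivity
  push_cast
  field_simp

theorem laplace_oddSolution (i : Fin m) {d : ℕ} {g : P m n} (hg : pd (Sum.inl i) g = 0)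
    (hE : euler m n g = (d : ℝ) • g) : laplace m n (oddSolution i d g) = 0 := by
  have h1 : laplace m n (oddSolution i d g) =
      pd (Sum.inl i) (pd (Sum.inl i) (oddSolution i d g)) + laplaceOff i (oddSolution i d g) := by
    simp [laplaceOff]
  -- `t j` is the second `x_i`-derivative of the `j`-th summand. It is minus `laplaceOff i` of the
  -- summand before, so the Laplacian telescopes; the end terms vanish because `g` is free of `x_i`
  -- and by `laplaceOff_pow_eq_zero`.
  let t : ℕ → P m n := fun j => ((-1 : ℝ) ^ j / ((2 * j).factorial : ℝ)) •
    pd (Sum.inl i) (coord (Sum.inl i) ^ (2 * j) * (laplaceOff i ^ j) g)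
  have h2 : ∀ j, t (j + 1) = -(((-1 : ℝ) ^ j / ((2 * j + 1).factorial : ℝ)) •
      (coord (Sum.inl i) ^ (2 * j + 1) * (laplaceOff i ^ (j + 1)) g)) := by
    intro j
    simp only [t]
    rw [show 2 * (j + 1) = 2 * j + 1 + 1 by ring,
      pd_coord_pow_mul i _ (pd_laplaceOff_pow i (j + 1) hg), smul_smul]
    refine Eq.trans ?_ (neg_smul _ (_ : P m n))
    congr 1
    rw [Nat.factorial_succ (2 * j + 1)]
    have : ((2 * j + 1).factorial : ℝ) ≠ 0 := by positivity
    push_cast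
    field_simp
    ring
  have h3 : t 0 = 0 := by simp [t, hg]
  have h4 : t (d + 1) = 0 := by simp [t, laplaceOff_pow_eq_zero i hE]
  have h5 : pd (Sum.inl i) (pd (Sum.inl i) (oddSolution i d g)) =
      ∑ j ∈ Finset.range (d + 1), t j := by
    simp only [pd_oddSolution i d hg, map_sum, map_smul, t]
  have h6 : laplaceOff i (oddSolution i d g) = ∑ j ∈ Finset.range (d + 1), -t (j + 1) := by
    simp only [oddSolution, map_sum, map_smul, h2, neg_neg, laplaceOff_coord_pow_mul]
    refine Finset.sum_congr rfl fun j _ => ?_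
    rw [pow_succ' (laplaceOff i), Module.End.mul_apply]
  rw [h1, h5, h6, ← Finset.sum_add_distrib]
  simp only [← sub_eq_add_neg]
  rw [Finset.sum_range_sub', h3, h4, sub_zero]

theorem euler_oddSolution (i : Fin m) {d : ℕ} {g : P m n}
    (hE : euler m n g = (d : ℝ) • g) :
    euler m n (oddSolution i d g) = ((d + 1 : ℕ) : ℝ) • oddSolution i d g := by
  simp only [oddSolution, map_sum, map_smul, Finset.smul_sum, euler_coord_pow_mul,
    euler_laplaceOff_pow i _ hE, mul_smul_comm]
  refine Finset.sum_congr rfl fun j _ => ?_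
  push_cast
  module

/-- The restriction of superpolynomials to `x_i = 0`. -/
def restrict (i : Fin m) : P m n →ₐ[ℝ] P m n :=
  Algebra.TensorProduct.map
    (MvPolynomial.aeval fun j => if j = i then 0 else MvPolynomial.X j) (AlgHom.id ℝ _)

theorem restrict_coord_self (i : Fin m) : restrict i (coord (Sum.inl i) : P m n) = 0 := by
  simp [restrict, coord]

theorem restrict_coord {i : Fin m} {l : Idx m n} (h : l ≠ Sum.inl i) :
    restrict i (coord l) = coord l := by
  rcases l with l | l
  · have : l ≠ i := fun h' => h (by rw [h'])
    simp [restrict, coord, this]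
  · simp [restrict, coord]

/-- Differentiating in `x_i` and restricting to `x_i = 0` returns `g`. -/
theorem oddSolution_ne_zero (i : Fin m) (d : ℕ) {g : P m n} (hg : pd (Sum.inl i) g = 0)
    (hr : restrict i g = g) (h0 : g ≠ 0) : oddSolution i d g ≠ 0 := by
  intro h
  have h1 := congrArg (restrict i) (pd_oddSolution i d hg)
  rw [h, map_zero, map_zero, Finset.sum_range_succ', map_add, map_sum,
    Finset.sum_eq_zero fun j _ => ?_, zero_add] at h1
  · simp [hr] at h1
    exact h0 h1.symm
  · rw [map_smul, map_mul, map_pow, restrict_coord_self, zero_pow (by omega), zero_mul, smul_zero]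

/-! ### Monomials as Cauchy data -/

theorem euler_list_prod (l : List (Idx m n)) :
    euler m n (l.map coord).prod = (l.length : ℝ) • (l.map coord).prod := by
  induction l with
  | nil => simp [euler_one]
  | cons i l ih =>
    rw [List.map_cons, List.prod_cons, euler_coord_mul, ih, mul_smul_comm, List.length_cons]
    push_cast
    module

theorem pd_list_prod {i : Idx m n} {l : List (Idx m n)} (h : i ∉ l) :
    pd i (l.map coord).prod = 0 := by
  induction l with
  | nil => simp [pd_one]
  | cons j l ih =>
    rw [List.mem_cons, not_or] at h
    rw [List.map_cons, List.prod_cons, pd_coord_mul, ih h.2, if_neg h.1, zero_smul, mul_zero,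
      smul_zero, add_zero]

theorem restrict_list_prod {i : Fin m} {l : List (Idx m n)} (h : Sum.inl i ∉ l) :
    restrict i (l.map coord).prod = (l.map coord).prod := by
  induction l with
  | nil => simp
  | cons j l ih =>
    rw [List.mem_cons, not_or] at h
    rw [List.map_cons, List.prod_cons, map_mul, ih h.2, restrict_coord (Ne.symm h.1)]

/-- The derivative in the first coordinate strips it off, since it does not recur in the list. -/
theorem list_prod_ne_zero {l : List (Idx m n)} (h : l.Nodup) : (l.map coord).prod ≠ 0 := by
  induction l with
  | nil => simp
  | cons i l ih =>
    rw [List.nodup_cons] at h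
    intro h0
    have := congrArg (pd i) h0
    rw [List.map_cons, List.prod_cons, pd_coord_mul, pd_list_prod h.1, if_pos rfl, one_smul,
      mul_zero, smul_zero, add_zero, map_zero] at this
    exact ih h.2 this

theorem coord_pow_ne_zero (i : Fin m) (r : ℕ) : coord (Sum.inl i : Idx m n) ^ r ≠ 0 := by
  induction r with
  | zero => simp
  | succ r ih =>
    intro h0
    have := pd_coord_pow_mul i r (pd_one (n := n) (Sum.inl i))
    rw [mul_one, h0, map_zero, mul_one] at this
    exact (smul_ne_zero (by positivity) ih) this.symm

theorem exists_mem_H_ne_zero (hm : m ≠ 0) (k : ℕ) (hk : m = 1 → k ≤ 2 * n + 1) :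
    ∃ p ∈ H m n k, p ≠ 0 := by
  rcases k with _ | d
  · exact ⟨1, mem_H_iff.2 ⟨by simp [euler_one], by simp [laplace_eq_sum_D, D_one]⟩, one_ne_zero⟩
  let i : Fin m := ⟨0, Nat.pos_of_ne_zero hm⟩
  obtain ⟨l, hl, hi, h0⟩ : ∃ l : List (Idx m n), l.length = d ∧ Sum.inl i ∉ l ∧
      (l.map coord).prod ≠ 0 := by
    -- A datum of degree `d = k - 1` without `x_0`. If `m = 1` only odd variables remain, and `d`
    -- distinct ones exist exactly when `k ≤ 2n + 1`; otherwise a power of a second even variable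
    -- serves.
    by_cases h1 : m = 1
    · let l : List (Fin n ⊕ Fin n) := (Finset.univ.toList).take d
      refine ⟨l.map Sum.inr, ?_, by simp, list_prod_ne_zero ?_⟩
      · have := hk h1
        simp only [l, List.length_map, List.length_take, Finset.length_toList, Finset.card_univ,
          Fintype.card_sum, Fintype.card_fin]
        omega
      · exact ((Finset.nodup_toList _).sublist (List.take_sublist _ _)).map Sum.inr_injective
    · refine ⟨List.replicate d (Sum.inl ⟨1, by omega⟩), by simp, fun h => ?_, ?_⟩
      · have := Sum.inl_injective (List.eq_of_mem_replicate h)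
        simp [i] at this
      · rw [List.map_replicate, List.prod_replicate]
        exact coord_pow_ne_zero _ _
  have hE := euler_list_prod l
  rw [hl] at hE
  exact ⟨oddSolution i d _, mem_H_iff.2
    ⟨euler_oddSolution i hE, laplace_oddSolution i (pd_list_prod hi) hE⟩,
    oddSolution_ne_zero i d (pd_list_prod hi) (restrict_list_prod hi) h0⟩

/-! ## The action of `𝔬𝔰𝔭(m|2n)` -/

theorem P.neg_smul (c : ℝ) (p : P m n) : (-c) • p = -(c • p) := _root_.neg_smul c p

theorem P.smul_neg (c : ℝ) (p : P m n) : c • (-p) = -(c • p) := _root_.smul_neg c p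

theorem P.sub_smul (c d : ℝ) (p : P m n) : (c - d) • p = c • p - d • p := _root_.sub_smul c d p

theorem P.smul_sub (c : ℝ) (p q : P m n) : c • (p - q) = c • p - c • q := _root_.smul_sub c p q

theorem P.mul_neg (p q : P m n) : p * -q = -(p * q) := _root_.mul_neg p q

theorem form_apply (i j : Idx m n) : form m n i j = if star i = j then (cf i)⁻¹ else 0 := by
  rcases i with i | i | i <;> rcases j with j | j | j <;>
    simp [form, star, cf, Matrix.J, Matrix.one_apply]
  split_ifs <;> simp

theorem superTranspose_apply (X : Matrix (Idx m n) (Idx m n) ℝ) (i j : Idx m n) :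
    superTranspose X i j = kos (par i) (par i + par j) * X j i := by
  have h : (1 : ZMod 2) + 1 = 0 := by decide
  rcases i with i | i <;> rcases j with j | j <;>
    simp [superTranspose, kos, par, h, toBlocks₁₁, toBlocks₁₂, toBlocks₂₁, toBlocks₂₂]

/-- The coefficients of the vector field of `X` with respect to the `X_l ∂_{X_k}`. -/
def twist (X : Matrix (Idx m n) (Idx m n) ℝ) (k l : Idx m n) : ℝ :=
  kos (par k) (par k + par l) * X k l

/-- The coefficients of the vector field of `X` with respect to the `X_l ∂_{X^j}`. -/
def lowered (X : Matrix (Idx m n) (Idx m n) ℝ) (l j : Idx m n) : ℝ :=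
  -(twist X (star j) l * (cf j)⁻¹)

theorem inv_cf_star (i : Idx m n) : (cf (star i))⁻¹ = sg i i * (cf i)⁻¹ := by
  rw [cf_star, mul_inv, inv_eq_of_mul_eq_one_left (sg_mul_self i i)]

/-- With an index lowered, the defining condition becomes graded antisymmetry. So the vector fields
of `𝔬𝔰𝔭(m|2n)` are the graded antisymmetric combinations of the `X_l D_j`. -/
theorem mem_osp_iff (X : Matrix (Idx m n) (Idx m n) ℝ) :
    X ∈ osp m n ↔ ∀ l j, lowered X l j = -(sg l j * lowered X j l) := by
  have h : X ∈ osp m n ↔ superTranspose X * form m n + form m n * X = 0 := Iff.rfl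
  rw [h, ← Matrix.ext_iff]
  refine forall_congr' fun l => forall_congr' fun j => ?_
  have h1 : (superTranspose X * form m n) l j =
      kos (par l) (par l + par j) * X (star j) l * (sg j j * (cf j)⁻¹) := by
    rw [Matrix.mul_apply, Finset.sum_eq_single (star j)]
    · rw [superTranspose_apply, form_apply, star_star, if_pos rfl, par_star, inv_cf_star]
    · intro b _ hb
      rw [form_apply, if_neg fun h => hb (star_eq_iff.1 h), mul_zero]
    · simp
  have h2 : (form m n * X) l j = (cf l)⁻¹ * X (star l) j := by
    rw [Matrix.mul_apply, Finset.sum_eq_single (star l)]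
    · rw [form_apply, if_pos rfl]
    · intro b _ hb
      rw [form_apply, if_neg (Ne.symm hb), zero_mul]
    · simp
  rw [Matrix.add_apply, h1, h2, Matrix.zero_apply]
  have hl : kos (par l) (par l + par j) = sg l l * sg l j := kos_add_right _ _ _
  have hj : kos (par j) (par j + par l) = sg j j * sg j l := kos_add_right _ _ _
  simp only [lowered, twist, par_star, hl, hj]
  have e1 := sg_mul_self l l
  have e2 := sg_mul_self l j
  rw [sg_comm j l]
  constructor
  · intro h
    linear_combination -sg l l * h + sg l j * sg j j * X (star j) l * (cf j)⁻¹ * e1 -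
      sg l l * X (star l) j * (cf l)⁻¹ * e2
  · intro h
    linear_combination -sg l l * h - X (star l) j * (cf l)⁻¹ * (sg l j ^ 2 * e1 + e2)


theorem vf_apply (X : osp m n) (p : P m n) :
    vf X p = -∑ k, ∑ l, twist X.1 k l • (coord l * pd k p) := by
  simp [vf, twist, LinearMap.sum_apply]

theorem vf_apply_lowered (X : osp m n) (p : P m n) :
    vf X p = ∑ l, ∑ j, lowered X.1 l j • (coord l * D j p) := by
  rw [vf_apply, Finset.sum_comm, ← Finset.sum_neg_distrib]
  refine Finset.sum_congr rfl fun l _ => ?_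
  rw [← sum_star, ← Finset.sum_neg_distrib]
  refine Finset.sum_congr rfl fun j _ => ?_
  rw [lowered, D, LinearMap.smul_apply, mul_smul_comm, smul_smul, neg_mul, mul_assoc,
    inv_mul_cancel₀ (cf_ne_zero _), mul_one]
  rw [P.neg_smul]

theorem euler_vf (X : osp m n) (p : P m n) : euler m n (vf X p) = vf X (euler m n p) := by
  simp only [vf_apply, map_neg, map_sum, map_smul, euler_coord_mul, euler_pd, mul_sub,
    add_sub_cancel]

/-- Graded antisymmetric coefficients are paired with graded commuting derivatives, so the sum
equals its negative. It is the whole commutator of `vf X` with the Laplacian, up to the factor `2`.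
-/
theorem sum_lowered_D_D (X : osp m n) (p : P m n) :
    ∑ l, ∑ j, lowered X.1 l j • D l (D j p) = 0 := by
  have h : ∑ l, ∑ j, lowered X.1 l j • D l (D j p) =
      -∑ l, ∑ j, lowered X.1 l j • D l (D j p) := by
    conv_rhs => rw [Finset.sum_comm]
    simp only [← Finset.sum_neg_distrib]
    refine Finset.sum_congr rfl fun l _ => Finset.sum_congr rfl fun j _ => ?_
    rw [D_D l j, (mem_osp_iff X.1).1 X.2 l j, smul_smul, neg_mul, mul_right_comm, sg_mul_self,
      one_mul]
    rw [P.neg_smul]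
  have h2 : (2 : ℝ) • ∑ l, ∑ j, lowered X.1 l j • D l (D j p) = 0 := by
    rw [two_smul]
    exact eq_neg_iff_add_eq_zero.1 h
  exact (smul_eq_zero.1 h2).resolve_left two_ne_zero

theorem laplace_vf (X : osp m n) (p : P m n) : laplace m n (vf X p) = vf X (laplace m n p) := by
  simp only [vf_apply_lowered, map_sum, map_smul, laplace_coord_mul, laplace_D, smul_add,
    Finset.sum_add_distrib]
  have := sum_lowered_D_D X p
  simp only [smul_comm _ (2 : ℝ), ← Finset.smul_sum, this, smul_zero, zero_add]

theorem vf_mem_H {k : ℕ} (X : osp m n) {p : P m n} (hp : p ∈ H m n k) : vf X p ∈ H m n k := by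
  rw [mem_H_iff] at hp ⊢
  rw [euler_vf, laplace_vf, hp.1, hp.2, map_smul, map_zero]
  exact ⟨rfl, rfl⟩

/-- Each operator `L a b` is the action of an element of `𝔬𝔰𝔭(m|2n)`. -/
theorem exists_vf_eq_L (a b : Idx m n) : ∃ X : osp m n, ∀ p, vf X p = L a b p := by
  -- `t` holds the coefficients of `L a b` with respect to the `X_l D_j`, and `X` is obtained by
  -- inverting `lowered`.
  let t : Idx m n → Idx m n → ℝ := fun l j =>
    (if l = a ∧ j = b then 1 else 0) - sg a b * (if l = b ∧ j = a then 1 else 0)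
  let X : Matrix (Idx m n) (Idx m n) ℝ := fun k l =>
    -(kos (par k) (par k + par l) * t l (star k) * cf (star k))
  have hX : ∀ l j, lowered X l j = t l j := by
    intro l j
    simp only [lowered, twist, X, star_star]
    have h1 := kos_mul_self (par (star j)) (par (star j) + par l)
    have h2 := mul_inv_cancel₀ (cf_ne_zero j)
    linear_combination t l j * cf j * (cf j)⁻¹ * h1 + t l j * h2
  have hmem : X ∈ osp m n := by
    rw [mem_osp_iff]
    intro l j
    simp only [hX, t]
    have h1 := sg_mul_self a b
    by_cases h : l = a ∧ j = b
    · obtain ⟨rfl, rfl⟩ := h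
      simp only [and_self, and_comm (a := j = l), if_true]
      split_ifs <;> linear_combination -h1
    · by_cases h' : l = b ∧ j = a
      · obtain ⟨rfl, rfl⟩ := h'
        simp only [h, and_self, if_true, if_false, and_comm (a := j = l), sg_comm j l]
        simp
      · rw [if_neg h, if_neg h', if_neg fun h2 => h' h2.symm, if_neg fun h2 => h h2.symm]
        simp
  refine ⟨⟨X, hmem⟩, fun p => ?_⟩
  rw [vf_apply_lowered]
  simp only [hX, t, L, P.sub_smul, mul_smul, ite_and, ite_smul, one_smul, zero_smul, smul_ite,
    smul_zero, Finset.sum_sub_distrib, Finset.sum_ite_irrel, Finset.sum_const_zero,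
    Finset.sum_ite_eq', Finset.mem_univ, if_true]

/-- The superderivation `vf X` on a coordinate. -/
def vfCoord (X : Matrix (Idx m n) (Idx m n) ℝ) (j : Idx m n) : P m n :=
  ∑ l, twist X j l • coord l

/-! ### Superderivation property and brackets of the vector fields -/

theorem vf_one (X : osp m n) : vf X (1 : P m n) = 0 := by simp [vf_apply, pd_one]

/-- The entries of a matrix vanish outside the positions of parity `a`. -/
def EntriesHomog (a : ZMod 2) (X : Matrix (Idx m n) (Idx m n) ℝ) : Prop :=
  ∀ k l, X k l ≠ 0 → par l = par k + a

theorem eps_injective {a b : ZMod 2} (h : eps a = eps b) : a = b := by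
  rcases zmod_two_cases a with rfl | rfl <;> rcases zmod_two_cases b with rfl | rfl <;>
    first | rfl | (simp [eps] at h; norm_num at h)

theorem sgnMat_mul_mul_apply (X : Matrix (Idx m n) (Idx m n) ℝ) (k l : Idx m n) :
    (sgnMat m n * X * sgnMat m n) k l = eps (par k) * X k l * eps (par l) := by
  have h : sgnMat m n = Matrix.diagonal fun i => eps (par i) := by
    ext i j
    rcases i with i | i <;> rcases j with j | j <;>
      simp [sgnMat, Matrix.diagonal, Matrix.one_apply, eps, par]
    split_ifs <;> simp
  rw [h, Matrix.mul_diagonal, Matrix.diagonal_mul]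

theorem IsHomog.entriesHomog {a : ZMod 2} {X : osp m n} (h : IsHomog a X) :
    EntriesHomog a X.1 := by
  intro k l hX
  have h1 := congrFun (congrFun h k) l
  rw [sgnMat_mul_mul_apply, Matrix.smul_apply, smul_eq_mul, mul_right_comm, ← eps_add] at h1
  rw [← eps_injective (mul_right_cancel₀ hX h1), ← add_assoc, CharTwo.add_self_eq_zero, zero_add]

theorem EntriesHomog.mul {a b : ZMod 2} {X Y : Matrix (Idx m n) (Idx m n) ℝ}
    (hX : EntriesHomog a X) (hY : EntriesHomog b Y) : EntriesHomog (a + b) (X * Y) := by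
  intro k l h
  rw [Matrix.mul_apply] at h
  obtain ⟨j, _, hj⟩ := Finset.exists_ne_zero_of_sum_ne_zero h
  rw [hY j l (right_ne_zero_of_mul hj), hX k j (left_ne_zero_of_mul hj), add_assoc]

theorem twist_ne_zero {X : Matrix (Idx m n) (Idx m n) ℝ} {k l : Idx m n} (h : twist X k l ≠ 0) :
    X k l ≠ 0 := right_ne_zero_of_mul h

theorem vf_coord_mul {a : ZMod 2} {X : osp m n} (hX : EntriesHomog a X.1) (j : Idx m n)
    (p : P m n) :
    vf X (coord j * p) = kos a (par j) • (coord j * vf X p) - vfCoord X.1 j * p := by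
  have h : ∀ k l, twist X.1 k l • (coord l * pd k (coord j * p)) =
      (if k = j then twist X.1 k l • (coord l * p) else 0) +
        kos a (par j) • (coord j * (twist X.1 k l • (coord l * pd k p))) := by
    intro k l
    rw [pd_coord_mul, mul_add, smul_add]
    congr 1
    · split_ifs <;> simp
    -- The sign rule requires `par l = par k + a`, which homogeneity gives only where the entry is
    -- nonzero.
    · by_cases h0 : twist X.1 k l = 0
      · simp [h0]
      · have h1 : sg k j = kos a (par j) * sg l j := by
          rw [sg, sg, hX k l (twist_ne_zero h0), kos_add_left, mul_left_comm, kos_mul_self, mul_one]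
        rw [mul_smul_comm, mul_smul_comm, coord_mul_coord_mul l j, h1]
        have := sg_mul_self l j
        match_scalars
        linear_combination twist X.1 k l * kos a (par j) * this
  simp only [vf_apply, h, Finset.sum_add_distrib, vfCoord]
  rw [Finset.sum_comm]
  simp only [Finset.sum_ite_eq', Finset.mem_univ, if_true, ← Finset.mul_sum,
    ← smul_mul_assoc, ← Finset.sum_mul, neg_add, P.mul_neg]
  simp only [smul_mul_assoc]
  module

theorem vf_vfCoord_mul {a b : ZMod 2} {X Y : osp m n} (hX : EntriesHomog a X.1)
    (hY : EntriesHomog b Y.1) (j : Idx m n) (p : P m n) :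
    vf X (vfCoord Y.1 j * p) = kos a (par j + b) • (vfCoord Y.1 j * vf X p) -
      (∑ l, twist Y.1 j l • vfCoord X.1 l) * p := by
  simp only [vfCoord, Finset.sum_mul, map_sum, smul_mul_assoc, map_smul, Finset.smul_sum,
    ← Finset.sum_sub_distrib]
  refine Finset.sum_congr rfl fun l _ => ?_
  rw [vf_coord_mul hX, smul_sub, vfCoord, Finset.sum_mul]
  congr 1
  · by_cases h0 : twist Y.1 j l = 0
    · simp [h0]
    · rw [hY j l (twist_ne_zero h0), smul_comm]
  · simp only [smul_mul_assoc, Finset.smul_sum]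

/-- The signs in `twist` make it multiplicative up to `kos a b`. This sign and the minus sign in
`vf` together account for the reversed order of composition on coordinates. -/
theorem twist_mul {a b : ZMod 2} {X Y : Matrix (Idx m n) (Idx m n) ℝ} (hX : EntriesHomog a X)
    (hY : EntriesHomog b Y) (j r : Idx m n) :
    ∑ l, twist X j l * twist Y l r = kos a b * twist (X * Y) j r := by
  simp only [twist, Matrix.mul_apply, Finset.mul_sum]
  refine Finset.sum_congr rfl fun l _ => ?_
  by_cases h1 : X j l = 0
  · simp [h1]
  by_cases h2 : Y l r = 0
  · simp [h2]
  have h3 : ∀ c : ZMod 2, c + c = 0 := CharTwo.add_self_eq_zero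
  rw [hY l r h2, hX j l h1]
  simp only [← add_assoc, h3, zero_add, kos_add_left, kos_add_right]
  ring

theorem vf_bracket {a b : ZMod 2} {X Y Z : osp m n} (h : IsBracket a b X Y Z) :
    vf Z = vf X ∘ₗ vf Y - kos a b • (vf Y ∘ₗ vf X) := by
  obtain ⟨hX', hY', hZ⟩ := h
  have hX := hX'.entriesHomog
  have hY := hY'.entriesHomog
  have hZ' : EntriesHomog (a + b) Z.1 := by
    intro k l h
    rw [hZ, Matrix.sub_apply, Matrix.smul_apply] at h
    by_cases h1 : (X.1 * Y.1) k l = 0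
    · refine add_comm b a ▸ hY.mul hX k l fun h2 => h ?_
      rw [h1, h2, smul_zero, sub_zero]
    · exact hX.mul hY k l h1
  have hc : ∀ j, vfCoord Z.1 j = kos a b • (∑ l, twist X.1 j l • vfCoord Y.1 l) -
      ∑ l, twist Y.1 j l • vfCoord X.1 l := by
    intro j
    have key : ∀ {a b : ZMod 2} {X Y : Matrix (Idx m n) (Idx m n) ℝ}, EntriesHomog a X →
        EntriesHomog b Y → (∑ l, twist X j l • vfCoord Y l) = kos a b • vfCoord (X * Y) j := by
      intro a b X Y hX hY
      simp only [vfCoord, Finset.smul_sum, smul_smul]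
      rw [Finset.sum_comm]
      simp only [← Finset.sum_smul, twist_mul hX hY]
    rw [key hX hY, key hY hX, smul_smul, kos_mul_self, one_smul, hZ, kos_comm b a]
    simp only [vfCoord, Finset.smul_sum, ← Finset.sum_sub_distrib, smul_smul, ← P.sub_smul]
    refine Finset.sum_congr rfl fun l _ => ?_
    congr 1
    simp only [twist, Matrix.sub_apply, Matrix.smul_apply, smul_eq_mul]
    ring
  -- Both sides obey the Leibniz rule of parity `a + b` and kill `1`, so agreement on the
  -- coordinates, which is `hc`, is enough.
  refine eq_of_coord_mul (by simp [vf_one]) fun j p hp => ?_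
  simp only [LinearMap.sub_apply, LinearMap.smul_apply, LinearMap.comp_apply] at hp ⊢
  rw [vf_coord_mul hZ', hp, vf_coord_mul hX, vf_coord_mul hY, map_sub, map_sub, map_smul, map_smul,
    vf_coord_mul hX, vf_coord_mul hY, vf_vfCoord_mul hX hY, vf_vfCoord_mul hY hX, hc]
  simp only [sub_mul, smul_mul_assoc, mul_sub, mul_smul_comm, P.smul_sub, smul_smul, kos_add_left,
    kos_add_right, kos_comm b a]
  have h1 := kos_mul_self a b
  match_scalars <;> first | ring1 | linear_combination -kos b (par j) * h1

theorem parityP_vf {a : ZMod 2} {X : osp m n} (hX : EntriesHomog a X.1) (p : P m n) :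
    parityP m n (vf X p) = eps a • vf X (parityP m n p) := by
  simp only [vf_apply, map_neg, map_sum, map_smul, map_mul, parityP_coord, parityP_pd, smul_neg,
    Finset.smul_sum]
  congr 1
  refine Finset.sum_congr rfl fun k _ => Finset.sum_congr rfl fun l _ => ?_
  by_cases h0 : twist X.1 k l = 0
  · simp [h0]
  · rw [hX k l (twist_ne_zero h0), eps_add, smul_mul_assoc, mul_smul_comm]
    have := eps_mul_self (par k)
    match_scalars
    linear_combination twist X.1 k l * eps a * this

theorem vf_add (X Y : osp m n) : vf (X + Y) = vf X + vf Y := by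
  refine LinearMap.ext fun p => ?_
  simp only [vf_apply, LinearMap.add_apply, twist, Submodule.coe_add, Matrix.add_apply, mul_add,
    add_smul, Finset.sum_add_distrib, neg_add]

theorem vf_smul (c : ℝ) (X : osp m n) : vf (c • X) = c • vf X := by
  refine LinearMap.ext fun p => ?_
  simp only [vf_apply, LinearMap.smul_apply, twist, Submodule.coe_smul, Matrix.smul_apply,
    smul_eq_mul, mul_left_comm _ c, mul_smul, Finset.smul_sum, P.smul_neg]

/-! ## The action of `SO(m) × Sp(2n)` -/

theorem act_coord (g : G0 m n) (i : Idx m n) :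
    act g (coord i) = ∑ j, toMat g⁻¹ i j • coord j := by
  rcases i with i | i
  · simp only [act, coord, Algebra.TensorProduct.map_tmul, MvPolynomial.aeval_X, map_one,
      Fintype.sum_sum_type, toMat, fromBlocks_apply₁₁, fromBlocks_apply₁₂, Matrix.zero_apply,
      zero_smul, Finset.sum_const_zero, add_zero, TensorProduct.sum_tmul, MvPolynomial.C_mul',
      TensorProduct.smul_tmul']
  · have h : Matrix.toLin' ((g⁻¹).2.1)ᵀ (Pi.single i (1 : ℝ)) =
        ∑ j, (g⁻¹).2.1 i j • (Pi.single j (1 : ℝ) : Fin n ⊕ Fin n → ℝ) := by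
      ext j
      simp [Matrix.toLin'_apply, Finset.sum_apply, Pi.single_apply]
    refine Eq.trans ?_ (Fintype.sum_sum_type _).symm
    simp only [act, coord, Algebra.TensorProduct.map_tmul, map_one, ExteriorAlgebra.map_apply_ι, h,
      toMat, fromBlocks_apply₂₁, fromBlocks_apply₂₂, Matrix.zero_apply, zero_smul,
      Finset.sum_const_zero, zero_add]
    rw [map_sum, TensorProduct.tmul_sum]
    exact Finset.sum_congr rfl fun j _ => by rw [map_smul, TensorProduct.tmul_smul]

theorem toMat_eq_zero_or (g : G0 m n) (i j : Idx m n) : toMat g i j = 0 ∨ par i = par j := by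
  rcases i with i | i <;> rcases j with j | j <;> simp [toMat, par]

theorem toMat_mul_sg (g : G0 m n) (i j k : Idx m n) :
    toMat g i j * sg j k = toMat g i j * sg i k := by
  rcases toMat_eq_zero_or g i j with h | h
  · simp [h]
  · rw [sg, sg, h]

/-- The chain rule for a linear substitution. No extra sign appears because the matrix of `g`
preserves parity (`toMat_mul_sg`). -/
theorem pd_act (g : G0 m n) (j : Idx m n) (p : P m n) :
    pd j (act g p) = ∑ i, toMat g⁻¹ i j • act g (pd i p) := by
  have : pd j ∘ₗ (act g).toLinearMap = ∑ i, toMat g⁻¹ i j • ((act g).toLinearMap ∘ₗ pd i) := by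
    refine eq_of_coord_mul (by simp [pd_one, LinearMap.sum_apply]) fun l p hp => ?_
    simp only [LinearMap.comp_apply, LinearMap.sum_apply, LinearMap.smul_apply,
      AlgHom.toLinearMap_apply] at hp ⊢
    have h1 : pd j (act g (coord l * p)) = toMat g⁻¹ l j • act g p +
        ∑ r, (toMat g⁻¹ l r * sg j r) • (coord r * pd j (act g p)) := by
      rw [map_mul, act_coord, Finset.sum_mul, map_sum]
      simp only [smul_mul_assoc, map_smul, pd_coord_mul, smul_add, Finset.sum_add_distrib,
        smul_smul, ite_smul, one_smul, zero_smul, smul_ite, smul_zero, Finset.sum_ite_eq,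
        Finset.mem_univ, if_true]
    have h2 : ∀ i, toMat g⁻¹ i j • act g (pd i (coord l * p)) =
        (if i = l then toMat g⁻¹ l j • act g p else 0) +
          ∑ r, (toMat g⁻¹ l r * sg j r) • (coord r * (toMat g⁻¹ i j • act g (pd i p))) := by
      intro i
      rw [pd_coord_mul, map_add, map_smul, map_smul, map_mul, act_coord, Finset.sum_mul, smul_add]
      congr 1
      · split_ifs with h
        · rw [h, one_smul]
        · simp
      · rw [smul_smul, Finset.smul_sum]
        refine Finset.sum_congr rfl fun r _ => ?_
        rw [smul_mul_assoc, mul_smul_comm, smul_smul, smul_smul, ← toMat_mul_sg g⁻¹ i j l,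
          sg_comm j r, toMat_mul_sg g⁻¹ l r j, sg_comm l j]
        congr 1
        ring
    simp only [h1, h2, Finset.sum_add_distrib, Finset.sum_ite_eq', Finset.mem_univ, if_true]
    congr 1
    rw [Finset.sum_comm]
    simp only [← Finset.smul_sum, ← Finset.mul_sum, ← hp]
  have h := LinearMap.congr_fun this p
  simpa [LinearMap.sum_apply] using h

theorem euler_act (g : G0 m n) (p : P m n) : euler m n (act g p) = act g (euler m n p) := by
  simp only [euler_apply, pd_act, map_sum, map_mul, act_coord, Finset.sum_mul, Finset.mul_sum,
    smul_mul_assoc, mul_smul_comm]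
  rw [Finset.sum_comm]

/-- The metric as a matrix. -/
def metMat (m n : ℕ) : Matrix (Idx m n) (Idx m n) ℝ := Matrix.of met

theorem form_mul_metMat : form m n * (metMat m n)ᵀ = 1 := by
  ext i k
  rw [Matrix.mul_apply, Finset.sum_eq_single (star i)]
  · simp only [form_apply, if_true, metMat, Matrix.transpose_apply, Matrix.of_apply, met,
      Matrix.one_apply]
    by_cases h : i = k
    · subst h; simp [cf_ne_zero]
    · have : star k ≠ star i := fun h' => h (by rw [← star_star i, ← h', star_star])
      simp [h, this]
  · intro b _ hb
    rw [form_apply, if_neg (Ne.symm hb), zero_mul]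
  · simp

/-- The metric is the transposed inverse of `form`, so invariance of the form passes to it by
inversion. The Laplacian is thereby invariant. -/
theorem toMat_metMat (g : G0 m n) : toMat g * metMat m n * (toMat g)ᵀ = metMat m n := by
  have h1 := toMat_form g
  have h2 := form_mul_metMat (m := m) (n := n)
  have h3 : (metMat m n)ᵀ * form m n = 1 := mul_eq_one_comm.1 h2
  have h4 : toMat g * (metMat m n)ᵀ * (toMat g)ᵀ = (metMat m n)ᵀ := by
    calc _ = toMat g * (metMat m n)ᵀ * (toMat g)ᵀ * (form m n * (toMat g * toMat g⁻¹) *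
          (metMat m n)ᵀ) := by rw [toMat_mul_inv, mul_one, h2, mul_one]
      _ = toMat g * (metMat m n)ᵀ * ((toMat g)ᵀ * form m n * toMat g) * toMat g⁻¹ *
          (metMat m n)ᵀ := by simp only [mul_assoc]
      _ = toMat g * ((metMat m n)ᵀ * form m n) * toMat g⁻¹ * (metMat m n)ᵀ := by
          rw [h1]; simp only [mul_assoc]
      _ = _ := by rw [h3, mul_one, toMat_mul_inv, one_mul]
  have := congrArg Matrix.transpose h4
  simpa [Matrix.transpose_mul, mul_assoc] using this

theorem laplace_eq_sum_pd (p : P m n) :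
    laplace m n p = ∑ i, ∑ j, met i j • pd j (pd i p) := by
  rw [laplace_eq_sum_D]
  refine Finset.sum_congr rfl fun i _ => ?_
  simp only [met, ite_smul, zero_smul, Finset.sum_ite_eq, Finset.mem_univ, if_true]
  simp only [D, star_star, LinearMap.smul_apply, map_smul, smul_smul]
  rw [← mul_assoc, ec_mul_cf_star, one_mul]

theorem laplace_act (g : G0 m n) (p : P m n) : laplace m n (act g p) = act g (laplace m n p) := by
  have h : ∀ a b : Idx m n,
      met a b = ∑ i, ∑ j, toMat g⁻¹ a i * met i j * toMat g⁻¹ b j := by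
    intro a b
    have := congrFun (congrFun (toMat_metMat g⁻¹) a) b
    rw [Matrix.mul_apply] at this
    simp only [Matrix.mul_apply, metMat, Matrix.of_apply, Matrix.transpose_apply,
      Finset.sum_mul] at this
    rw [← this, Finset.sum_comm]
  simp only [laplace_eq_sum_pd, pd_act, map_sum, map_smul, Finset.smul_sum, smul_smul]
  have h2 : ∀ a b : Idx m n, met a b • act g (pd b (pd a p)) =
      ∑ i, ∑ j, (toMat g⁻¹ a i * met i j * toMat g⁻¹ b j) • act g (pd b (pd a p)) := by
    intro a b
    conv_lhs => rw [h a b]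
    simp only [Finset.sum_smul]
  simp only [h2]
  rw [Finset.sum_congr rfl fun a _ => Finset.sum_comm, Finset.sum_comm]
  refine Finset.sum_congr rfl fun i _ => ?_
  rw [Finset.sum_congr rfl fun a _ => Finset.sum_comm]
  rw [Finset.sum_comm' (t' := Finset.univ) (s' := fun _ => Finset.univ) (by simp)]
  refine Finset.sum_congr rfl fun j _ => Finset.sum_congr rfl fun a _ =>
    Finset.sum_congr rfl fun b _ => ?_
  congr 1
  ring

theorem act_mem_H {k : ℕ} (g : G0 m n) {p : P m n} (hp : p ∈ H m n k) : act g p ∈ H m n k := by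
  rw [mem_H_iff] at hp ⊢
  rw [euler_act, laplace_act, hp.1, hp.2, map_smul, map_zero]
  exact ⟨rfl, rfl⟩

theorem act_one : act (1 : G0 m n) = AlgHom.id ℝ (P m n) := by
  have h : (act (1 : G0 m n)).toLinearMap = LinearMap.id := by
    refine eq_of_coord_mul (by simp) fun l p hp => ?_
    simp only [AlgHom.toLinearMap_apply, LinearMap.id_apply] at hp ⊢
    have h1 : toMat (1 : G0 m n) = 1 := by simp [toMat]
    simp [hp, act_coord, h1, Matrix.one_apply]
  exact AlgHom.toLinearMap_injective h

theorem act_act_coord (g h : G0 m n) (l : Idx m n) :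
    act g (act h (coord l)) = act (g * h) (coord l) := by
  have h1 : ∀ r, toMat (g * h)⁻¹ l r = ∑ j, toMat h⁻¹ l j * toMat g⁻¹ j r := fun r => by
    rw [_root_.mul_inv_rev, toMat_mul, Matrix.mul_apply]
  rw [act_coord h, act_coord (g * h), map_sum]
  simp only [h1, Finset.sum_smul]
  rw [Finset.sum_comm]
  refine Finset.sum_congr rfl fun j _ => ?_
  rw [map_smul, act_coord, Finset.smul_sum]
  exact Finset.sum_congr rfl fun r _ => smul_smul _ _ _

theorem act_mul (g h : G0 m n) : act (g * h) = (act g).comp (act h) := by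
  have h : (act (g * h)).toLinearMap = ((act g).comp (act h)).toLinearMap := by
    refine eq_of_coord_mul (by simp) fun l p hp => ?_
    simp only [AlgHom.toLinearMap_apply, AlgHom.comp_apply] at hp ⊢
    rw [map_mul, hp, map_mul, map_mul, act_act_coord]
  exact AlgHom.toLinearMap_injective h

theorem parityP_act (g : G0 m n) (p : P m n) :
    parityP m n (act g p) = act g (parityP m n p) := by
  have h : (parityP m n).toLinearMap ∘ₗ (act g).toLinearMap =
      (act g).toLinearMap ∘ₗ (parityP m n).toLinearMap := by
    refine eq_of_coord_mul (by simp) fun l p hp => ?_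
    simp only [AlgHom.toLinearMap_apply, LinearMap.comp_apply] at hp ⊢
    rw [map_mul, map_mul, map_mul, map_mul, hp]
    congr 1
    simp only [act_coord, map_sum, map_smul, parityP_coord, Finset.smul_sum]
    refine Finset.sum_congr rfl fun j _ => ?_
    rcases toMat_eq_zero_or g⁻¹ l j with h | h
    · simp [h]
    · rw [h, smul_comm]
  exact LinearMap.congr_fun h p

theorem twist_mul_toMat (X : Matrix (Idx m n) (Idx m n) ℝ) (g : G0 m n) (i r : Idx m n) :
    ∑ j, twist X i j * toMat g j r = twist (X * toMat g) i r := by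
  simp only [twist, Matrix.mul_apply, Finset.mul_sum]
  refine Finset.sum_congr rfl fun j _ => ?_
  rcases toMat_eq_zero_or g j r with h | h
  · simp [h]
  · rw [h]; ring

theorem toMat_mul_twist (X : Matrix (Idx m n) (Idx m n) ℝ) (g : G0 m n) (i r : Idx m n) :
    ∑ j, toMat g i j * twist X j r = twist (toMat g * X) i r := by
  simp only [twist, Matrix.mul_apply, Finset.mul_sum]
  refine Finset.sum_congr rfl fun j _ => ?_
  rcases toMat_eq_zero_or g i j with h | h
  · simp [h]
  · rw [h]; ring

/-- After the chain rule both sides have the same shape, with coefficient matrices `g⁻¹ Ad(g)X` and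
`X g⁻¹`, which coincide. -/
theorem vf_Ad_act (g : G0 m n) (X : osp m n) (p : P m n) :
    vf (Ad g X) (act g p) = act g (vf X p) := by
  have hS : toMat g⁻¹ * (Ad g X).1 = X.1 * toMat g⁻¹ := by
    change toMat g⁻¹ * (toMat g * X.1 * toMat g⁻¹) = _
    rw [← mul_assoc, ← mul_assoc, toMat_inv_mul, one_mul]
  have h1 : vf (Ad g X) (act g p) =
      -∑ i, ∑ r, twist (toMat g⁻¹ * (Ad g X).1) i r • (coord r * act g (pd i p)) := by
    rw [vf_apply]
    congr 1
    have h : ∀ k r, twist (Ad g X).1 k r • (coord r * pd k (act g p)) =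
        ∑ i, (toMat g⁻¹ i k * twist (Ad g X).1 k r) • (coord r * act g (pd i p)) := by
      intro k r
      rw [pd_act, Finset.mul_sum, Finset.smul_sum]
      refine Finset.sum_congr rfl fun i _ => ?_
      rw [mul_smul_comm, smul_smul, mul_comm]
    simp only [h, ← toMat_mul_twist, Finset.sum_smul]
    rw [Finset.sum_congr rfl fun k _ => Finset.sum_comm, Finset.sum_comm]
    exact Finset.sum_congr rfl fun i _ => Finset.sum_comm
  have h2 : act g (vf X p) =
      -∑ i, ∑ r, twist (X.1 * toMat g⁻¹) i r • (coord r * act g (pd i p)) := by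
    rw [vf_apply, map_neg]
    congr 1
    simp only [map_sum]
    refine Finset.sum_congr rfl fun i _ => ?_
    have h : ∀ l, act g (twist X.1 i l • (coord l * pd i p)) =
        ∑ r, (twist X.1 i l * toMat g⁻¹ l r) • (coord r * act g (pd i p)) := by
      intro l
      rw [map_smul, map_mul, act_coord, Finset.sum_mul, Finset.smul_sum]
      refine Finset.sum_congr rfl fun r _ => ?_
      rw [smul_mul_assoc, smul_smul]
    simp only [h, ← twist_mul_toMat, Finset.sum_smul]
    rw [Finset.sum_comm]
  rw [h1, h2, hS]

/-! ## Smoothness of the group action -/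

/-- The block matrix of the inverse of an element of `SO(m) × Sp(2n)`, as a linear map on the
ambient space. -/
def invMat (m n : ℕ) : Amb m n →ₗ[ℝ] Matrix (Idx m n) (Idx m n) ℝ where
  toFun a := fromBlocks (Matrix.of a.1)ᵀ 0 0
    (-(Matrix.J (Fin n) ℝ * (Matrix.of a.2)ᵀ * Matrix.J (Fin n) ℝ))
  map_add' a b := by
    have h1 : Matrix.of (a + b).1 = Matrix.of a.1 + Matrix.of b.1 := rfl
    have h2 : Matrix.of (a + b).2 = Matrix.of a.2 + Matrix.of b.2 := rfl
    rw [h1, h2, fromBlocks_add, Matrix.transpose_add, Matrix.transpose_add, mul_add, add_mul,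
      neg_add, add_zero, add_zero]
  map_smul' c a := by
    have h1 : Matrix.of (c • a).1 = c • Matrix.of a.1 := rfl
    have h2 : Matrix.of (c • a).2 = c • Matrix.of a.2 := rfl
    rw [h1, h2, Matrix.transpose_smul, Matrix.transpose_smul, mul_smul_comm, smul_mul_assoc,
      ← smul_neg, RingHom.id_apply, fromBlocks_smul, smul_zero, smul_zero]

/-- On the group `A⁻¹ = Aᵀ` and `B⁻¹ = -J Bᵀ J`. Inversion thus extends linearly to all pairs of
matrices, and matrix coefficients have polynomial extensions. -/
theorem invMat_toAmb (g : G0 m n) : invMat m n (toAmb g) = toMat g⁻¹ := by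
  have h : invMat m n (toAmb g) * toMat g = 1 := by
    have h1 : g.1.1ᵀ * g.1.1 = 1 := by
      have := (Matrix.mem_specialOrthogonalGroup_iff.1 g.1.2).1
      rw [Matrix.mem_orthogonalGroup_iff'] at this
      simpa [Matrix.star_eq_conjTranspose] using this
    have h2 : g.2.1ᵀ * Matrix.J (Fin n) ℝ * g.2.1 = Matrix.J (Fin n) ℝ :=
      SymplecticGroup.mem_iff'.1 g.2.2
    change fromBlocks g.1.1ᵀ 0 0 (-(Matrix.J (Fin n) ℝ * g.2.1ᵀ * Matrix.J (Fin n) ℝ)) *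
      fromBlocks g.1.1 0 0 g.2.1 = 1
    have h3 : Matrix.J (Fin n) ℝ * g.2.1ᵀ * Matrix.J (Fin n) ℝ * g.2.1 = -1 := by
      rw [Matrix.mul_assoc, Matrix.mul_assoc, ← Matrix.mul_assoc g.2.1ᵀ, h2, Matrix.J_squared]
    simp [fromBlocks_multiply, h1, h3]
  calc invMat m n (toAmb g) = invMat m n (toAmb g) * (toMat g * toMat g⁻¹) := by
        rw [toMat_mul_inv, mul_one]
    _ = toMat g⁻¹ := by rw [← mul_assoc, h, one_mul]

/-- The differential of inversion at the identity. The formula rests on the infinitesimal relations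
`Aᵀ = -A` and `Bᵀ J = -J B`. -/
theorem invMat_tangent {X : osp m n} (hX : IsHomog 0 X) :
    invMat m n (mkAmb X.1.toBlocks₁₁ X.1.toBlocks₂₂) = -X.1 := by
  have hE := hX.entriesHomog
  have hosp : superTranspose X.1 * form m n + form m n * X.1 = 0 := X.2
  have h12 : X.1.toBlocks₁₂ = 0 := by
    ext i j
    by_contra h
    simpa [par] using hE (Sum.inl i) (Sum.inr j) h
  have h21 : X.1.toBlocks₂₁ = 0 := by
    ext i j
    by_contra h
    simpa [par] using hE (Sum.inr i) (Sum.inl j) h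
  rw [← fromBlocks_toBlocks X.1, h12, h21] at hosp ⊢
  generalize X.1.toBlocks₁₁ = A at *
  generalize X.1.toBlocks₂₂ = B at *
  simp only [superTranspose, form, toBlocks_fromBlocks₁₁, toBlocks_fromBlocks₁₂,
    toBlocks_fromBlocks₂₁, toBlocks_fromBlocks₂₂, fromBlocks_multiply, fromBlocks_add] at hosp
  rw [← fromBlocks_zero, fromBlocks_inj] at hosp
  obtain ⟨h1, -, -, h2⟩ := hosp
  have h1' : Aᵀ = -A := by
    have : Aᵀ + A = 0 := by simpa using h1
    exact eq_neg_of_add_eq_zero_left this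
  have h2' : Bᵀ * Matrix.J (Fin n) ℝ = -(Matrix.J (Fin n) ℝ * B) := by
    have : (-(1 / 2 : ℝ)) • (Bᵀ * Matrix.J (Fin n) ℝ + Matrix.J (Fin n) ℝ * B) = 0 := by
      simpa [smul_add] using h2
    exact eq_neg_of_add_eq_zero_left ((smul_eq_zero.1 this).resolve_left (by norm_num))
  change fromBlocks Aᵀ 0 0 (-(Matrix.J (Fin n) ℝ * Bᵀ * Matrix.J (Fin n) ℝ)) = -fromBlocks A 0 0 B
  rw [Matrix.mul_assoc, h2', Matrix.mul_neg, ← Matrix.mul_assoc, Matrix.J_squared, h1',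
    fromBlocks_neg]
  simp

/-- An entry of `invMat` as a continuous linear functional. -/
def invEntry (l r : Idx m n) : Amb m n →L[ℝ] ℝ :=
  LinearMap.toContinuousLinearMap
    ((Matrix.entryLinearMap ℝ ℝ l r) ∘ₗ invMat m n)

theorem invEntry_apply (l r : Idx m n) (a : Amb m n) : invEntry l r a = invMat m n a l r := rfl

/-- The superpolynomials `p` such that `g ↦ g · p` is a finite sum of smooth functions times
superpolynomials, with derivative `vf X p` at `1`. -/
def smoothVectors (X : osp m n) : Submodule ℝ (P m n) where
  carrier := {p | ∃ (ι : Type) (_ : Fintype ι) (c : ι → Amb m n → ℝ) (q : ι → P m n),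
    (∀ i, ContDiff ℝ ∞ (c i)) ∧ (∀ g, act g p = ∑ i, c i (toAmb g) • q i) ∧
    vf X p = ∑ i, fderiv ℝ (c i) (toAmb 1) (mkAmb X.1.toBlocks₁₁ X.1.toBlocks₂₂) • q i}
  zero_mem' := ⟨Empty, inferInstance, Empty.elim, Empty.elim, fun i => i.elim, by simp, by simp⟩
  add_mem' := by
    rintro p p' ⟨ι, _, c, q, h1, h2, h3⟩ ⟨ι', _, c', q', h1', h2', h3'⟩
    refine ⟨ι ⊕ ι', inferInstance, Sum.elim c c', Sum.elim q q', ?_, fun g => ?_, ?_⟩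
    · rintro (i | i)
      exacts [h1 i, h1' i]
    · simp [h2, h2']
    · simp [h3, h3']
  smul_mem' := by
    rintro a p ⟨ι, _, c, q, h1, h2, h3⟩
    refine ⟨ι, inferInstance, c, fun i => a • q i, h1, fun g => ?_, ?_⟩
    · rw [map_smul, h2, Finset.smul_sum]
      exact Finset.sum_congr rfl fun i _ => smul_comm _ _ _
    · rw [map_smul, h3, Finset.smul_sum]
      exact Finset.sum_congr rfl fun i _ => smul_comm _ _ _

/-- `act g` is multiplicative and linear in the entries of `g⁻¹` on coordinates, so a factor `coord
l` multiplies the coefficient functions by linear ones. The product rule at the identity reproduces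
`vf_coord_mul`. -/
theorem smoothVectors_eq_top {X : osp m n} (hX : IsHomog 0 X) : smoothVectors X = ⊤ := by
  have hE := hX.entriesHomog
  refine eq_top_of_coord_mul _ ?_ fun l p hp => ?_
  · refine ⟨Unit, inferInstance, fun _ _ => 1, fun _ => 1, fun _ => contDiff_const, ?_, ?_⟩
    · simp
    · simp [vf_one]
  · obtain ⟨ι, _, c, q, h1, h2, h3⟩ := hp
    refine ⟨Idx m n × ι, inferInstance, fun x a => invEntry l x.1 a * c x.2 a,
      fun x => coord x.1 * q x.2, fun x => (invEntry l x.1).contDiff.mul (h1 x.2), fun g => ?_, ?_⟩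
    · rw [map_mul, act_coord, h2, Finset.sum_mul_sum, Fintype.sum_prod_type]
      simp only [invEntry_apply, invMat_toAmb, smul_mul_assoc, mul_smul_comm, mul_smul]
      exact Finset.sum_congr rfl fun _ _ => Finset.sum_congr rfl fun _ _ => smul_comm _ _ _
    · have hd : ∀ x : Idx m n × ι, fderiv ℝ (fun a => invEntry l x.1 a * c x.2 a) (toAmb 1)
          (mkAmb X.1.toBlocks₁₁ X.1.toBlocks₂₂) =
          (if l = x.1 then 1 else 0) *
            fderiv ℝ (c x.2) (toAmb 1) (mkAmb X.1.toBlocks₁₁ X.1.toBlocks₂₂) -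
          twist X.1 l x.1 * c x.2 (toAmb 1) := by
        intro x
        rw [fderiv_fun_mul (invEntry l x.1).differentiableAt
          ((h1 x.2).differentiable (by simp) _), ContinuousLinearMap.fderiv]
        have e1 : invEntry l x.1 (toAmb 1) = if l = x.1 then 1 else 0 := by
          rw [invEntry_apply, invMat_toAmb, inv_one, show toMat (1 : G0 m n) = 1 by simp [toMat],
            Matrix.one_apply]
        have e2 : invEntry l x.1 (mkAmb X.1.toBlocks₁₁ X.1.toBlocks₂₂) = -twist X.1 l x.1 := by
          rw [invEntry_apply, invMat_tangent hX, Matrix.neg_apply, twist]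
          by_cases h0 : X.1 l x.1 = 0
          · simp [h0]
          · rw [hE l x.1 h0, add_zero, CharTwo.add_self_eq_zero]; simp [kos]
        simp only [_root_.add_apply, _root_.smul_apply, e1, e2,
          smul_eq_mul]
        ring
      have h4 : p = ∑ i, c i (toAmb 1) • q i := by
        rw [← h2, act_one]; rfl
      simp only [hd, Fintype.sum_prod_type, P.sub_smul, Finset.sum_sub_distrib]
      rw [vf_coord_mul hE, h3]
      conv_lhs => rw [h4]
      congr 1
      · simp [kos, Finset.mul_sum, mul_smul_comm]
      · rw [vfCoord, Finset.sum_mul_sum]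
        simp only [smul_mul_assoc, mul_smul_comm, mul_smul]
        exact Finset.sum_congr rfl fun _ _ => Finset.sum_congr rfl fun _ _ => smul_comm _ _ _

/-- The representation of the Harish-Chandra pair on the spherical harmonics. -/
def harmonicRep (m n k : ℕ) : HCRep m n (H m n k) (Hgr m n k) where
  grp :=
    { toFun := fun g => (act g).toLinearMap.restrict fun _ hp => act_mem_H g hp
      map_one' := by
        ext1 v; apply Subtype.ext
        change act 1 v.1 = v.1
        rw [act_one]; rfl
      map_mul' := fun g h => by
        ext1 v; apply Subtype.ext
        change act (g * h) v.1 = act g (act h v.1)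
        rw [act_mul]; rfl }
  grp_even g a v hv := by
    have hv' : parityP m n v.1 - eps a • v.1 = 0 := hv
    change parityP m n (act g v.1) - eps a • act g v.1 = 0
    rw [parityP_act, ← map_smul, ← map_sub, hv', map_zero]
  alg :=
    { toFun := fun X => (vf X).restrict fun _ hp => vf_mem_H X hp
      map_add' := fun X Y => by
        ext1 v; apply Subtype.ext
        change vf (X + Y) v.1 = vf X v.1 + vf Y v.1
        rw [vf_add]; rfl
      map_smul' := fun c X => by
        ext1 v; apply Subtype.ext
        change vf (c • X) v.1 = c • vf X v.1
        rw [vf_smul]; rfl }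
  alg_parity a X hX b v hv := by
    have hv' : parityP m n v.1 - eps b • v.1 = 0 := hv
    change parityP m n (vf X v.1) - eps (a + b) • vf X v.1 = 0
    rw [parityP_vf hX.entriesHomog, sub_eq_zero.1 hv', map_smul, smul_smul, ← eps_add, sub_self]
  alg_bracket a b X Y Z h := by
    ext1 v; apply Subtype.ext
    change vf Z v.1 = vf X (vf Y v.1) - kos a b • vf Y (vf X v.1)
    rw [vf_bracket h]; rfl
  deriv_grp X hX v φ := by
    -- The superpolynomials `q i` need not be harmonic, so the functional has to be defined on all
    -- of `P m n`.
    obtain ⟨ψ, hψ⟩ := φ.exists_extend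
    have hφ : ∀ w : H m n k, φ w = ψ w.1 := fun w => by rw [← hψ]; rfl
    obtain ⟨ι, _, c, q, h1, h2, h3⟩ :=
      (smoothVectors_eq_top hX ▸ Submodule.mem_top : v.1 ∈ smoothVectors X)
    refine ⟨fun a => ∑ i, c i a * ψ (q i),
      ⟨ContDiff.sum fun i _ => (h1 i).mul contDiff_const, fun g => ?_⟩, ?_⟩
    · refine Eq.trans ?_ (hφ _).symm
      change _ = ψ (act g v.1)
      simp only [h2, map_sum, map_smul, smul_eq_mul]
    · refine Eq.trans ?_ (hφ _).symm
      change _ = ψ (vf X v.1)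
      have hd : HasFDerivAt (fun a => ∑ i, c i a * ψ (q i))
          (∑ i, ψ (q i) • fderiv ℝ (c i) (toAmb 1)) (toAmb (1 : G0 m n)) :=
        HasFDerivAt.fun_sum fun i _ =>
          ((h1 i).differentiable (by simp) _).hasFDerivAt.mul_const (ψ (q i))
      rw [hd.fderiv, h3]
      simp only [map_sum, map_smul, smul_eq_mul, _root_.sum_apply,
        _root_.smul_apply]
      refine Finset.sum_congr rfl fun i _ => ?_
      rw [mul_comm]
      simp
  alg_Ad g X := by
    ext1 v; apply Subtype.ext
    change vf (Ad g X) v.1 = act g (vf X (act g⁻¹ v.1))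
    rw [← vf_Ad_act, ← AlgHom.comp_apply, ← act_mul, mul_inv_cancel, act_one]; rfl

theorem harmonicRep_isIrreducible {m n k : ℕ}
    (hM : ∀ j : ℕ, (m : ℤ) - 2 * (n : ℤ) ≠ -2 * (j : ℤ)) (hk : m = 1 → k ≤ 2 * n + 1) :
    (harmonicRep m n k).IsIrreducible := by
  have hm : m ≠ 0 := by
    rintro rfl
    -- For `m = 0` one would have `M = -2n`.
    exact hM n (by push_cast; ring)
  refine ⟨?_, fun W _ hW => ?_⟩
  · obtain ⟨p, hp, h0⟩ := exists_mem_H_ne_zero (n := n) hm k hk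
    exact nontrivial_of_ne (⟨p, hp⟩ : H m n k) 0 fun h => h0 (congrArg Subtype.val h)
  · have hle : W.map (H m n k).subtype ≤ H m n k := Submodule.map_subtype_le _ _
    have hL : ∀ i j, ∀ w ∈ W.map (H m n k).subtype, L i j w ∈ W.map (H m n k).subtype := by
      rintro i j _ ⟨w, hw, rfl⟩
      obtain ⟨X, hX⟩ := exists_vf_eq_L i j
      exact ⟨_, hW X w hw, hX w.1⟩
    refine (eq_bot_or_eq_H hM k _ hle hL).imp (fun h => ?_) fun h => ?_ <;>
      refine Submodule.map_injective_of_injective (Submodule.subtype_injective (H m n k)) ?_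
    · rw [h, Submodule.map_bot]
    · rw [h, Submodule.map_subtype_top]

/-! ## Integration of representations of the Harish-Chandra pair -/

theorem U_induction {C : U m n → Prop} (halg : ∀ r : ℝ, C (algebraMap ℝ (U m n) r))
    (hι : ∀ X, C (uι m n X)) (hmul : ∀ a b, C a → C b → C (a * b))
    (hadd : ∀ a b, C a → C b → C (a + b)) (u : U m n) : C u := by
  obtain ⟨t, rfl⟩ : ∃ t, uMk m n t = u := RingQuot.mkAlgHom_surjective ℝ (URel m n) u
  induction t using TensorAlgebra.induction with
  | algebraMap r => rw [AlgHom.commutes]; exact halg r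
  | ι X => exact hι X
  | mul a b ha hb => rw [map_mul]; exact hmul _ _ ha hb
  | add a b ha hb => rw [map_add]; exact hadd _ _ ha hb

theorem uParity_uι (X : osp m n) : uParity m n (uι m n X) = uι m n (ospParity m n X) :=
  uMap_uι _ _ X

theorem uAd_uι (g : G0 m n) (X : osp m n) : uAd g (uι m n X) = uι m n (Ad g X) := uMap_uι _ _ X

theorem uParity_uParity (u : U m n) : uParity m n (uParity m n u) = u := by
  induction u using U_induction with
  | halg r => simp
  | hι X =>
    rw [uParity_uι, uParity_uι]
    congr 1
    apply Subtype.ext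
    change sgnMat m n * (sgnMat m n * X.1 * sgnMat m n) * sgnMat m n = X.1
    rw [mul_assoc, mul_assoc, sgnMat_mul_self, mul_one, ← mul_assoc, sgnMat_mul_self, one_mul]
  | hmul a b ha hb => rw [map_mul, map_mul, ha, hb]
  | hadd a b ha hb => rw [map_add, map_add, ha, hb]

theorem uAd_one (u : U m n) : uAd 1 u = u := by
  induction u using U_induction with
  | halg r => simp
  | hι X =>
    rw [uAd_uι]
    congr 1
    apply Subtype.ext
    change toMat 1 * X.1 * toMat 1⁻¹ = X.1
    have h : toMat (1 : G0 m n) = 1 := by simp [toMat]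
    rw [inv_one, h, one_mul, mul_one]
  | hmul a b ha hb => rw [map_mul, ha, hb]
  | hadd a b ha hb => rw [map_add, ha, hb]

theorem funParity_funParity (f : Fun m n) : funParity m n (funParity m n f) = f := by
  refine Subtype.ext (LinearMap.ext fun u => ?_)
  change f.1 (uParity m n (uParity m n u)) = f.1 u
  rw [uParity_uParity]

theorem ev_funParity (u : U m n) (g : G0 m n) (f : Fun m n) :
    ev u g (funParity m n f) = ev (uParity m n u) g f := rfl

/-- Left translation by `g⁻¹` is the restriction of a linear map of the ambient space, along which
smooth extensions pull back. -/
theorem HasDerivAlong.translate {f : G0 m n → ℝ} {X : Matrix (Idx m n) (Idx m n) ℝ} {d : ℝ}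
    (h : HasDerivAlong f X 1 d) (g : G0 m n) : HasDerivAlong (fun h => f (g⁻¹ * h)) X g d := by
  obtain ⟨F, ⟨hF, hFf⟩, hd⟩ := h
  let T : Amb m n →ₗ[ℝ] Amb m n :=
    { toFun := fun a => mkAmb (g⁻¹.1.1 * Matrix.of a.1) (g⁻¹.2.1 * Matrix.of a.2)
      map_add' := fun a b => by
        have h1 : Matrix.of (a + b).1 = Matrix.of a.1 + Matrix.of b.1 := rfl
        have h2 : Matrix.of (a + b).2 = Matrix.of a.2 + Matrix.of b.2 := rfl
        rw [h1, h2, mul_add, mul_add]; rfl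
      map_smul' := fun c a => by
        have h1 : Matrix.of (c • a).1 = c • Matrix.of a.1 := rfl
        have h2 : Matrix.of (c • a).2 = c • Matrix.of a.2 := rfl
        rw [h1, h2, mul_smul_comm, mul_smul_comm]; rfl }
  let T' : Amb m n →L[ℝ] Amb m n := LinearMap.toContinuousLinearMap T
  have hT : ∀ A B, T' (mkAmb A B) = mkAmb (g⁻¹.1.1 * A) (g⁻¹.2.1 * B) := fun _ _ => rfl
  have hTg : ∀ h : G0 m n, T' (toAmb h) = toAmb (g⁻¹ * h) := fun _ => rfl
  refine ⟨F ∘ T', ⟨hF.comp T'.contDiff, fun h => ?_⟩, ?_⟩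
  · rw [Function.comp_apply, hTg, hFf]
  · have h1 : T' (toAmb g) = toAmb 1 := by rw [hTg, inv_mul_cancel]
    have h2 : HasFDerivAt F (fderiv ℝ F (toAmb 1)) (T' (toAmb g)) := by
      rw [h1]; exact (hF.differentiable (by simp) _).hasFDerivAt
    rw [(h2.comp _ T'.hasFDerivAt).fderiv, ContinuousLinearMap.comp_apply, hT, ← hd]
    have e1 : g⁻¹.1.1 * g.1.1 = 1 := congrArg (fun h : G0 m n => h.1.1) (inv_mul_cancel g)
    have e2 : g⁻¹.2.1 * g.2.1 = 1 := congrArg (fun h : G0 m n => h.2.1) (inv_mul_cancel g)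
    have e3 : (1 : G0 m n).1.1 = 1 := rfl
    have e4 : (1 : G0 m n).2.1 = 1 := rfl
    rw [← Matrix.mul_assoc, ← Matrix.mul_assoc, e1, e2, e3, e4]

/-! ### Matrix coefficients and slices of a coaction -/

section

variable {V : Type} [AddCommGroup V] [Module ℝ V] {gr : ZMod 2 → Submodule ℝ V}

/-- The action of the universal enveloping algebra. -/
def HCRep.env (R : HCRep m n V gr) : U m n →ₐ[ℝ] Module.End ℝ V :=
  RingQuot.liftAlgHom ℝ ⟨TensorAlgebra.lift ℝ R.alg, by
    rintro _ _ ⟨a, b, X, Y, Z, h⟩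
    simp only [map_sub, map_smul, map_mul, TensorAlgebra.lift_ι_apply, R.alg_bracket a b X Y Z h]
    rfl⟩

theorem HCRep.env_uι (R : HCRep m n V gr) (X : osp m n) : R.env (uι m n X) = R.alg X := by
  refine (RingQuot.liftAlgHom_mkAlgHom_apply ℝ _ _ _).trans ?_
  rw [TensorAlgebra.lift_ι_apply]

theorem HCRep.env_uAd (R : HCRep m n V gr) (g : G0 m n) (u : U m n) (v : V) :
    R.env (uAd g u) (R.grp g v) = R.grp g (R.env u v) := by
  induction u using U_induction generalizing v with
  | halg r => simp [Module.algebraMap_end_apply]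
  | hι X =>
    rw [uAd_uι, R.env_uι, R.env_uι, R.alg_Ad]
    simp only [LinearMap.comp_apply]
    rw [← Module.End.mul_apply (R.grp g⁻¹), ← map_mul, inv_mul_cancel, map_one, Module.End.one_apply]
  | hmul a b ha hb => rw [map_mul, map_mul, map_mul, Module.End.mul_apply, hb, ha]; rfl
  | hadd a b ha hb => simp only [map_add, LinearMap.add_apply, ha, hb]

theorem HCRep.hasDerivAlong (R : HCRep m n V gr) {X : osp m n} (hX : IsHomog 0 X) (v : V)
    (φ : Module.Dual ℝ V) (g : G0 m n) :
    HasDerivAlong (fun h => φ (R.grp h v)) X.1 g (φ (R.grp g (R.alg X v))) := by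
  have h := (R.deriv_grp X hX v (φ ∘ₗ R.grp g)).translate g
  have e : (fun h => (φ ∘ₗ R.grp g) (R.grp (g⁻¹ * h) v)) = fun h => φ (R.grp h v) := by
    funext h
    rw [LinearMap.comp_apply, ← Module.End.mul_apply, ← map_mul, mul_inv_cancel_left]
  rwa [e] at h

/-- The matrix coefficients of a representation, as superfunctions. -/
def HCRep.coeff (R : HCRep m n V gr) (φ : Module.Dual ℝ V) : V →ₗ[ℝ] Fun m n where
  toFun v := ⟨LinearMap.pi fun g => φ ∘ₗ R.grp g ∘ₗ R.env.toLinearMap.flip v, by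
    refine ⟨fun u => ?_, fun X hX u g => ?_⟩
    -- Smoothness is part of `deriv_grp`; the tangent vector `0` is enough to extract it.
    · have h0 : IsHomog 0 (0 : osp m n) := by simp [IsHomog]
      obtain ⟨F, hF, -⟩ := R.deriv_grp 0 h0 (R.env u v) φ
      exact ⟨F, hF⟩
    · have := R.hasDerivAlong hX (R.env u v) φ g
      have e : R.env (uι m n X * u) v = R.alg X (R.env u v) := by
        rw [map_mul, R.env_uι]; rfl
      change HasDerivAlong (fun h => φ (R.grp h (R.env u v))) X.1 g
        (φ (R.grp g (R.env (uι m n X * u) v)))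
      rwa [e]⟩
  map_add' v w := by
    refine Subtype.ext (LinearMap.ext fun u => funext fun g => ?_)
    change φ (R.grp g (R.env u (v + w))) = φ (R.grp g (R.env u v)) + φ (R.grp g (R.env u w))
    simp only [map_add]
  map_smul' c v := by
    refine Subtype.ext (LinearMap.ext fun u => funext fun g => ?_)
    change φ (R.grp g (R.env u (c • v))) = c • φ (R.grp g (R.env u v))
    simp only [map_smul]

theorem HCRep.ev_coeff (R : HCRep m n V gr) (φ : Module.Dual ℝ V) (v : V) (u : U m n)
    (g : G0 m n) : ev u g (R.coeff φ v) = φ (R.grp g (R.env u v)) := rfl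

/-- Contraction of the first factor of `N ⊗ V` with a functional. -/
def contract {N : Type*} [AddCommGroup N] [Module ℝ N] (e : N →ₗ[ℝ] ℝ) : N ⊗[ℝ] V →ₗ[ℝ] V :=
  (TensorProduct.lid ℝ V).toLinearMap ∘ₗ e.rTensor V

theorem contract_tmul {N : Type*} [AddCommGroup N] [Module ℝ N] (e : N →ₗ[ℝ] ℝ) (x : N) (v : V) :
    contract e (x ⊗ₜ[ℝ] v) = e x • v := by simp [contract]

/-- A separating family of functionals on `N` separates the elements of `N ⊗ V`. -/
theorem eq_of_contract_eq {N T : Type*} [AddCommGroup N] [Module ℝ N] (e : T → N →ₗ[ℝ] ℝ)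
    (he : ∀ x y, (∀ t, e t x = e t y) → x = y) {z z' : N ⊗[ℝ] V}
    (h : ∀ t, contract (e t) z = contract (e t) z') : z = z' := by
  classical
  let b := Module.Free.chooseBasis ℝ V
  have key : ∀ t (z : N ⊗[ℝ] V) i, e t (TensorProduct.equivFinsuppOfBasisRight b z i) =
      b.repr (contract (e t) z) i := by
    intro t z i
    induction z using TensorProduct.induction_on with
    | zero => simp
    | add z z' hz hz' => simp only [map_add, Finsupp.add_apply, hz, hz']
    | tmul x v =>
      rw [TensorProduct.equivFinsuppOfBasisRight_apply_tmul_apply, contract_tmul]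
      simp [mul_comm]
  refine (TensorProduct.equivFinsuppOfBasisRight b).injective (Finsupp.ext fun i => he _ _ fun t => ?_)
  rw [key, key, h]

/-- The value of an element of `𝒪 ⊗ V` at the point distribution `g · u`. -/
def slice (u : U m n) (g : G0 m n) : Fun m n ⊗[ℝ] V →ₗ[ℝ] V := contract (ev u g)

theorem eq_of_slice_eq {z z' : Fun m n ⊗[ℝ] V}
    (h : ∀ (u : U m n) g, slice u g z = slice u g z') : z = z' :=
  eq_of_contract_eq (fun t : U m n × G0 m n => ev t.1 t.2)
    (fun _ _ hxy => Subtype.ext (LinearMap.ext fun u => funext fun g => hxy (u, g)))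
    fun t => h t.1 t.2

theorem slice_add (u w : U m n) (g : G0 m n) (z : Fun m n ⊗[ℝ] V) :
    slice (u + w) g z = slice u g z + slice w g z := by
  have h : ev (u + w) g = ev u g + ev w g := by
    ext f; exact congrFun (f.1.map_add u w) g
  simp only [slice, contract, h, LinearMap.rTensor_add, LinearMap.comp_apply, LinearMap.add_apply,
    map_add]

theorem slice_smul (c : ℝ) (u : U m n) (g : G0 m n) (z : Fun m n ⊗[ℝ] V) :
    slice (c • u) g z = c • slice u g z := by
  have h : ev (c • u) g = c • ev u g := by
    ext f; exact congrFun (f.1.map_smul c u) g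
  simp only [slice, contract, h, LinearMap.rTensor_smul, LinearMap.comp_apply,
    LinearMap.smul_apply, map_smul]

/-- For homogeneous arguments `f'(u)` vanishes unless `u` has the parity of `f'`, so the signs of
the embedding and of the flip cancel. -/
theorem ev_box_flip (u w : U m n) (g h : G0 m n) (f f' : Fun m n) :
    box m n (flip m n (f ⊗ₜ[ℝ] f')) u w g h = ev w h f * ev u g f' := by
  have hb : ∀ f f' : Fun m n, box m n (f ⊗ₜ[ℝ] f') u w g h = (1 / 2 : ℝ) *
      (ev u g f * ev w h f' + ev u g f * ev w h (funParity m n f') +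
        ev (uParity m n u) g f * ev w h f' -
        ev (uParity m n u) g f * ev w h (funParity m n f')) := fun _ _ => rfl
  have hf : flip m n (f ⊗ₜ[ℝ] f') = (1 / 2 : ℝ) • (f' ⊗ₜ[ℝ] f + f' ⊗ₜ[ℝ] funParity m n f +
      funParity m n f' ⊗ₜ[ℝ] f - funParity m n f' ⊗ₜ[ℝ] funParity m n f) := by
    simp [flip]
  have e : ∀ (a : ℝ) (x y z t : Fun2 m n),
      (a • (x + y + z - t)) u w g h = a * (x u w g h + y u w g h + z u w g h - t u w g h) :=
    fun _ _ _ _ _ => rfl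
  rw [hf, map_smul, map_sub, map_add, map_add, e, hb, hb, hb, hb]
  simp only [funParity_funParity, ev_funParity, uParity_uParity]
  ring

/-- Evaluation of elements of `Fun2`. -/
def ev2 (t : (U m n × U m n) × G0 m n × G0 m n) : Fun2 m n →ₗ[ℝ] ℝ where
  toFun F := F t.1.1 t.1.2 t.2.1 t.2.2
  map_add' _ _ := rfl
  map_smul' _ _ := rfl

theorem contract_ev2_box_flip (chi : V →ₗ[ℝ] Fun m n ⊗[ℝ] V) (u w : U m n) (g h : G0 m n)
    (z : Fun m n ⊗[ℝ] V) :
    contract (ev2 ((u, w), g, h)) ((box m n ∘ₗ flip m n).rTensor V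
      ((TensorProduct.assoc ℝ (Fun m n) (Fun m n) V).symm (chi.lTensor (Fun m n) z))) =
    slice u g (chi (slice w h z)) := by
  have key : ∀ (f : Fun m n) (y : Fun m n ⊗[ℝ] V),
      contract (ev2 ((u, w), g, h)) ((box m n ∘ₗ flip m n).rTensor V
        ((TensorProduct.assoc ℝ (Fun m n) (Fun m n) V).symm (f ⊗ₜ[ℝ] y))) =
      ev w h f • slice u g y := by
    intro f y
    induction y using TensorProduct.induction_on with
    | zero => simp
    | add y y' hy hy' => simp only [TensorProduct.tmul_add, map_add, hy, hy', smul_add]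
    | tmul f' v =>
      rw [TensorProduct.assoc_symm_tmul, LinearMap.rTensor_tmul, contract_tmul, slice,
        contract_tmul, smul_smul]
      congr 1
      exact ev_box_flip u w g h f f'
  induction z using TensorProduct.induction_on with
  | zero => simp
  | add z z' hz hz' => simp only [map_add, hz, hz']
  | tmul f v => rw [LinearMap.lTensor_tmul, key, slice, slice, contract_tmul, map_smul, map_smul]

theorem contract_ev2_mulSharp (u w : U m n) (g h : G0 m n) (z : Fun m n ⊗[ℝ] V) :
    contract (ev2 ((u, w), g, h)) ((mulSharp m n).rTensor V z) =
      slice (uAd h⁻¹ u * w) (g * h) z := by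
  induction z using TensorProduct.induction_on with
  | zero => simp
  | add z z' hz hz' => simp only [map_add, hz, hz']
  | tmul f v => rw [LinearMap.rTensor_tmul, contract_tmul, slice, contract_tmul]; rfl

theorem slice_map_funParity (σ : V →ₗ[ℝ] V) (u : U m n) (g : G0 m n) (z : Fun m n ⊗[ℝ] V) :
    slice u g (TensorProduct.map (funParity m n) σ z) = σ (slice (uParity m n u) g z) := by
  induction z using TensorProduct.induction_on with
  | zero => simp
  | add z z' hz hz' => simp only [map_add, hz, hz']
  | tmul f v =>
    rw [TensorProduct.map_tmul, slice, slice, contract_tmul, contract_tmul, map_smul, ev_funParity]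

/-- Coassociativity evaluated at point distributions: the module axiom for the product `(g · u)(h ·
w) = gh · (Ad(h⁻¹)u) w`. -/
theorem Corep.slice_slice (C : Corep m n V gr) (u w : U m n) (g h : G0 m n) (v : V) :
    slice u g (C.chi (slice w h (C.chi v))) = slice (uAd h⁻¹ u * w) (g * h) (C.chi v) := by
  rw [← contract_ev2_box_flip, C.coassoc, contract_ev2_mulSharp]

/-- An element of `𝒪 ⊗ V` of parity `a` is a sum of tensors with homogeneous factors. -/
theorem mem_iSup_of_map_parity_eq {σ : V →ₗ[ℝ] V} (hσ : ∀ v, σ (σ v) = v)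
    (hgr : ∀ a, gr a = LinearMap.ker (σ - eps a • LinearMap.id)) (a : ZMod 2)
    {z : Fun m n ⊗[ℝ] V} (hz : TensorProduct.map (funParity m n) σ z = eps a • z) :
    z ∈ ⨆ b : ZMod 2,
      LinearMap.range (TensorProduct.map (FunGr m n b).subtype (gr (a + b)).subtype) := by
  -- `pF c` and `pV c` are the projections onto the parts of parity `c`.
  let pF : ZMod 2 → Fun m n →ₗ[ℝ] Fun m n := fun c =>
    (1 / 2 : ℝ) • (LinearMap.id + eps c • funParity m n)
  let pV : ZMod 2 → V →ₗ[ℝ] V := fun c => (1 / 2 : ℝ) • (LinearMap.id + eps c • σ)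
  have hpF : ∀ c f, pF c f ∈ FunGr m n c := by
    intro c f
    simp only [FunGr, LinearMap.mem_ker, LinearMap.sub_apply, LinearMap.smul_apply,
      LinearMap.id_apply, pF, LinearMap.add_apply, map_smul, map_add, funParity_funParity]
    have := eps_mul_self c
    match_scalars
    · linear_combination (-1 / 2 : ℝ) * this
    · ring
  have hpV : ∀ c v, pV c v ∈ gr c := by
    intro c v
    rw [hgr]
    simp only [LinearMap.mem_ker, LinearMap.sub_apply, LinearMap.smul_apply,
      LinearMap.id_apply, pV, LinearMap.add_apply, map_smul, map_add, hσ]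
    have := eps_mul_self c
    match_scalars
    · linear_combination (-1 / 2 : ℝ) * this
    · ring
  have hcomp : ∀ c, pF c = eps c • (pF c ∘ₗ funParity m n) := by
    intro c
    refine LinearMap.ext fun f => ?_
    simp only [pF, LinearMap.smul_apply, LinearMap.comp_apply, LinearMap.add_apply,
      LinearMap.id_apply, funParity_funParity]
    have := eps_mul_self c
    match_scalars
    · linear_combination (-1 / 2 : ℝ) * this
    · ring
  have hσz : ∀ c, TensorProduct.map (pF c) σ z =
      eps (a + c) • TensorProduct.map (pF c) LinearMap.id z := by
    intro c
    have h1 : TensorProduct.map (pF c) σ z =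
        eps c • TensorProduct.map (pF c) LinearMap.id (TensorProduct.map (funParity m n) σ z) := by
      rw [← LinearMap.comp_apply, ← TensorProduct.map_comp, LinearMap.id_comp,
        ← LinearMap.smul_apply, ← TensorProduct.map_smul_left, ← hcomp]
    rw [h1, hz, map_smul, smul_smul, eps_add, mul_comm]
  -- Once the first factor has parity `c`, total parity `a` forces parity `a + c` on the second, so
  -- projecting it changes nothing.
  have hterm : ∀ c, TensorProduct.map (pF c) LinearMap.id z =
      TensorProduct.map (pF c) (pV (a + c)) z := by
    intro c
    simp only [pV, TensorProduct.map_smul_right, TensorProduct.map_add_right, LinearMap.smul_apply,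
      LinearMap.add_apply, hσz, smul_smul, eps_mul_self]
    module
  have hsum : z = TensorProduct.map (pF 0) LinearMap.id z +
      TensorProduct.map (pF 1) LinearMap.id z := by
    rw [← LinearMap.add_apply, ← TensorProduct.map_add_left]
    have : pF 0 + pF 1 = LinearMap.id := by
      refine LinearMap.ext fun f => ?_
      simp only [pF, eps, LinearMap.add_apply, LinearMap.smul_apply, LinearMap.id_apply, if_true,
        one_ne_zero, if_false]
      module
    rw [this, TensorProduct.map_id, LinearMap.id_apply]
  have hmem : ∀ c, TensorProduct.map (pF c) LinearMap.id z ∈ ⨆ b : ZMod 2,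
      LinearMap.range (TensorProduct.map (FunGr m n b).subtype (gr (a + b)).subtype) := by
    intro c
    refine Submodule.mem_iSup_of_mem c ⟨TensorProduct.map ((pF c).codRestrict _ (hpF c))
      ((pV (a + c)).codRestrict _ (hpV (a + c))) z, ?_⟩
    rw [hterm, ← LinearMap.comp_apply, ← TensorProduct.map_comp, LinearMap.subtype_comp_codRestrict,
      LinearMap.subtype_comp_codRestrict]
  rw [hsum]
  exact Submodule.add_mem _ (hmem 0) (hmem 1)

variable [Module.Finite ℝ V]

/-- The coaction with the matrix coefficients of `R`. -/
def HCRep.coaction (R : HCRep m n V gr) : V →ₗ[ℝ] Fun m n ⊗[ℝ] V :=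
  ∑ i, (TensorProduct.mk ℝ (Fun m n) V).flip (Module.finBasis ℝ V i) ∘ₗ
    R.coeff ((Module.finBasis ℝ V).coord i)

theorem HCRep.slice_coaction (R : HCRep m n V gr) (u : U m n) (g : G0 m n) (v : V) :
    slice u g (R.coaction v) = R.grp g (R.env u v) := by
  simp only [HCRep.coaction, LinearMap.sum_apply, map_sum, LinearMap.comp_apply,
    LinearMap.flip_apply, TensorProduct.mk_apply, slice, contract_tmul, R.ev_coeff]
  exact (Module.finBasis ℝ V).sum_repr _

/-- The corepresentation that integrates a representation of the Harish-Chandra pair. -/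
def HCRep.toCorep (R : HCRep m n V gr) (σ : V →ₗ[ℝ] V) (hσ : ∀ v, σ (σ v) = v)
    (hgr : ∀ a, gr a = LinearMap.ker (σ - eps a • LinearMap.id))
    (hgrp : ∀ g v, σ (R.grp g v) = R.grp g (σ v))
    (halg : ∀ X v, σ (R.alg (ospParity m n X) v) = R.alg X (σ v)) : Corep m n V gr where
  chi := R.coaction
  even a v hv := by
    refine mem_iSup_of_map_parity_eq hσ hgr a ?_
    -- The relation assumed for `𝔬𝔰𝔭(m|2n)` extends to the enveloping algebra multiplicatively,
    -- without splitting `u` into homogeneous parts.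
    have henv : ∀ (u : U m n) v, σ (R.env (uParity m n u) v) = R.env u (σ v) := by
      intro u
      induction u using U_induction with
      | halg r => intro v; simp [Module.algebraMap_end_apply]
      | hι X => intro v; rw [uParity_uι, R.env_uι, R.env_uι, halg]
      | hmul a b ha hb =>
        intro v
        rw [map_mul, map_mul, map_mul, Module.End.mul_apply, ha, hb, Module.End.mul_apply]
      | hadd a b ha hb => intro v; simp only [map_add, LinearMap.add_apply, ha, hb]
    have hv' : σ v = eps a • v := by
      rw [hgr] at hv
      simpa [sub_eq_zero] using hv
    refine eq_of_slice_eq fun u g => ?_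
    rw [slice_map_funParity, R.slice_coaction, hgrp, henv, hv', map_smul, map_smul, map_smul,
      R.slice_coaction]
  counit v := by
    change slice 1 1 (R.coaction v) = v
    rw [R.slice_coaction, map_one, map_one]; rfl
  coassoc v := by
    refine eq_of_contract_eq ev2 (fun x y h => ?_) fun t => ?_
    · funext u w g h'
      exact h ((u, w), g, h')
    · obtain ⟨⟨u, w⟩, g, h⟩ := t
      rw [contract_ev2_box_flip, contract_ev2_mulSharp]
      simp only [R.slice_coaction]
      have hinv : ∀ x, R.grp h (R.grp h⁻¹ x) = x := fun x => by
        rw [← Module.End.mul_apply (R.grp h), ← map_mul, mul_inv_cancel, map_one,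
          Module.End.one_apply]
      -- This moves `u` to the right past `h`, turning it into `Ad(h⁻¹)u`.
      have hAd := R.env_uAd h⁻¹ u (R.grp h (R.env w v))
      rw [← Module.End.mul_apply (R.grp h⁻¹), ← map_mul, inv_mul_cancel, map_one,
        Module.End.one_apply] at hAd
      rw [map_mul R.grp, map_mul R.env, Module.End.mul_apply, Module.End.mul_apply, hAd, hinv]

theorem HCRep.toCorep_induces (R : HCRep m n V gr) (σ : V →ₗ[ℝ] V) (hσ hgr hgrp halg) :
    (R.toCorep σ hσ hgr hgrp halg).Induces R := by
  refine ⟨fun g v => ?_, fun X v => ?_⟩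
  · change _ = slice 1 g (R.coaction v)
    rw [R.slice_coaction, map_one, Module.End.one_apply]
  · change _ = slice (uι m n X) 1 (R.coaction v)
    rw [R.slice_coaction, map_one, Module.End.one_apply, R.env_uι]

end

/-! ### Uniqueness and irreducibility of the induced corepresentation -/

section

variable {V : Type} [AddCommGroup V] [Module ℝ V] {gr : ZMod 2 → Submodule ℝ V}

/-- At the identity `slice_slice` makes slices multiplicative in `u`, so they are determined by
those at `𝔬𝔰𝔭(m|2n)`, which generates the enveloping algebra. One more composition, with the slice
at `1` and `g`, reaches all `g · u`. -/
theorem Corep.Induces.slice_chi {C : Corep m n V gr} {R : HCRep m n V gr} (h : C.Induces R)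
    (u : U m n) (g : G0 m n) (v : V) : slice u g (C.chi v) = R.grp g (R.env u v) := by
  have hgrp : ∀ g v, slice 1 g (C.chi v) = R.grp g v := fun g v => (h.1 g v).symm
  have h1 : ∀ v, slice u 1 (C.chi v) = R.env u v := by
    induction u using U_induction with
    | halg r =>
      intro v
      rw [Algebra.algebraMap_eq_smul_one, slice_smul, hgrp, map_one, map_smul, map_one]
      rfl
    | hι X => intro v; rw [R.env_uι]; exact (h.2 X v).symm
    | hmul a b ha hb =>
      intro v
      have := C.slice_slice a b 1 1 v
      rw [inv_one, uAd_one, mul_one] at this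
      rw [← this, hb, ha, map_mul]; rfl
    | hadd a b ha hb => intro v; rw [slice_add, ha, hb, map_add]; rfl
  have := C.slice_slice 1 u g 1 v
  rw [map_one, one_mul, mul_one] at this
  rw [← this, hgrp, h1]

/-- A corepresentation is determined by the representation that it induces. -/
theorem Corep.Induces.unique {C C' : Corep m n V gr} {R : HCRep m n V gr} (h : C.Induces R)
    (h' : C'.Induces R) : C' = C := by
  have hchi : C'.chi = C.chi := LinearMap.ext fun v => eq_of_slice_eq fun u g => by
    rw [h.slice_chi, h'.slice_chi]
  cases C
  cases C'
  congr

/-- If `χ(W) ⊆ 𝒪 ⊗ W` then every slice maps `W` to itself, and the operators of `R` are slices. -/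
theorem Corep.Induces.isIrreducible {C : Corep m n V gr} {R : HCRep m n V gr} (h : C.Induces R)
    (hR : R.IsIrreducible) : C.IsIrreducible := by
  refine ⟨hR.1, fun W hW => ?_⟩
  have hs : ∀ (u : U m n) g, ∀ w ∈ W, slice u g (C.chi w) ∈ W := by
    intro u g w hw
    obtain ⟨y, hy⟩ := hW w hw
    have key : ∀ y : Fun m n ⊗[ℝ] W, slice u g (W.subtype.lTensor (Fun m n) y) ∈ W := by
      intro y
      induction y using TensorProduct.induction_on with
      | zero => simp
      | add y y' hy hy' => rw [map_add, map_add]; exact W.add_mem hy hy'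
      | tmul f v =>
        rw [LinearMap.lTensor_tmul, slice, contract_tmul]
        exact W.smul_mem _ v.2
    rw [← hy]
    exact key y
  refine hR.2 W (fun g w hw => ?_) fun X w hw => ?_
  · rw [h.1]; exact hs 1 g w hw
  · rw [h.2]; exact hs _ 1 w hw

end

/-! ## The parity of spherical harmonics -/

theorem euler_parityP (p : P m n) :
    euler m n (parityP m n p) = parityP m n (euler m n p) := by
  simp only [euler_apply, map_sum, map_mul, parityP_coord, parityP_pd]
  refine Finset.sum_congr rfl fun i _ => ?_
  rw [smul_mul_assoc, mul_smul_comm, smul_smul, eps_mul_self, one_smul]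

theorem laplace_parityP (p : P m n) :
    laplace m n (parityP m n p) = parityP m n (laplace m n p) := by
  simp only [laplace_eq_sum_pd, map_sum, map_smul, parityP_pd]
  refine Finset.sum_congr rfl fun i _ => Finset.sum_congr rfl fun j _ => ?_
  rcases met_eq_zero_or i j with h | h
  · simp [h]
  · rw [← h, par_star, smul_smul (eps _), eps_mul_self, one_smul]

theorem parityP_mem_H {k : ℕ} {p : P m n} (hp : p ∈ H m n k) : parityP m n p ∈ H m n k := by
  rw [mem_H_iff] at hp ⊢
  rw [euler_parityP, laplace_parityP, hp.1, hp.2, map_smul, map_zero]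
  exact ⟨rfl, rfl⟩

/-- Stated for all `X`, homogeneous or not, because `HCRep.toCorep` asks for the parity relation on
the whole of `𝔬𝔰𝔭(m|2n)`. -/
theorem parityP_vf_ospParity (X : osp m n) (p : P m n) :
    parityP m n (vf (ospParity m n X) p) = vf X (parityP m n p) := by
  simp only [vf_apply, map_neg, map_sum, map_smul, map_mul, parityP_coord, parityP_pd]
  congr 1
  refine Finset.sum_congr rfl fun k _ => Finset.sum_congr rfl fun l _ => ?_
  have h : twist (ospParity m n X).1 k l = eps (par k) * eps (par l) * twist X.1 k l := by
    have h1 : (ospParity m n X).1 k l = eps (par k) * X.1 k l * eps (par l) :=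
      sgnMat_mul_mul_apply X.1 k l
    rw [twist, h1, twist]
    ring
  rw [h, smul_mul_assoc, mul_smul_comm]
  have h1 := eps_mul_self (par k)
  have h2 := eps_mul_self (par l)
  match_scalars
  linear_combination twist X.1 k l * (eps (par l) ^ 2 * h1 + h2)

/-- The parity operator of the spherical harmonics. -/
def parityH (m n k : ℕ) : H m n k →ₗ[ℝ] H m n k :=
  (parityP m n).toLinearMap.restrict fun _ hp => parityP_mem_H hp

/-- The corepresentation of `SOSp(m|2n)` on the spherical harmonics. -/
def harmonicCorep (m n k : ℕ) : Corep m n (H m n k) (Hgr m n k) :=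
  (harmonicRep m n k).toCorep (parityH m n k)
    (fun v => Subtype.ext (parityP_parityP v.1))
    (fun a => by
      ext v
      change parityP m n v.1 - eps a • v.1 = 0 ↔ parityH m n k v - eps a • v = 0
      exact (Subtype.ext_iff (a1 := parityH m n k v - eps a • v) (a2 := 0)).symm)
    (fun g v => Subtype.ext (parityP_act g v.1))
    (fun X v => Subtype.ext (parityP_vf_ospParity X v.1))

end SOSp

end

theorem mainTheorem12 (m n k : ℕ)
    (hM : ∀ j : ℕ, (m : ℤ) - 2 * (n : ℤ) ≠ -2 * (j : ℤ))
    (hk : m = 1 → k ≤ 2 * n + 1) :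
    ∃ R : SOSp.HCRep m n (SOSp.H m n k) (SOSp.Hgr m n k),
      (∀ (g : SOSp.G0 m n) (v : SOSp.H m n k),
        (R.grp g v : SOSp.P m n) = SOSp.act g (v : SOSp.P m n)) ∧
      (∀ (X : SOSp.osp m n) (v : SOSp.H m n k),
        (R.alg X v : SOSp.P m n) = SOSp.vf X (v : SOSp.P m n)) ∧
      R.IsIrreducible ∧
      ∃ C : SOSp.Corep m n (SOSp.H m n k) (SOSp.Hgr m n k),
        C.Induces R ∧
        (∀ C' : SOSp.Corep m n (SOSp.H m n k) (SOSp.Hgr m n k), C'.Induces R → C' = C) ∧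
        C.IsIrreducible := by
  have hirr := SOSp.harmonicRep_isIrreducible (k := k) hM hk
  have hind : (SOSp.harmonicCorep m n k).Induces (SOSp.harmonicRep m n k) :=
    SOSp.HCRep.toCorep_induces _ _ _ _ _ _
  exact ⟨SOSp.harmonicRep m n k, fun _ _ => rfl, fun _ _ => rfl, hirr,
    SOSp.harmonicCorep m n k, hind, fun _ h => hind.unique h, hind.isIrreducible hirr⟩
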